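/- A \emph{base} is a finite, connected graph $\Gamma$ with directed edges (edges with equal endpoints and multiple edges are allowed), together with a real number $h(e)$, the height change, for each edge $e$, such that some closed edge path of $\Gamma$ has strictly positive total height change; here edges may be traversed in either direction, and an edge $e$ traversed backwards contributes $-h(e)$. An \emph{admissible tree of valence at most $L$ over $\Gamma$} is a simplicial tree $V$ with directed edges of length 1 and all valences at most $L$, together with a morphism of directed graphs $p\colon V\to\Gamma$ such that for every vertex $v$ of $V$ and every edge $e$ of $\Gamma$ coming in to (respectively, going out of) $p(v)$, at least two edges coming in to (respectively, going out of) $v$ are mapped to $e$; if $\Gamma$ is not just a single vertex with a single edge, then for an edge $e$ whose initial and terminal vertices coincide it is only required that at least one edge coming in to $v$ and at least one edge going out of $v$ are mapped to $e$. The height change of an edge of $V$ is that of its image in $\Gamma$, and for vertices $x,y$ of $V$, $h_V(x,y)$ is the sum of the height changes along the path from $x$ to $y$ (edges crossed backwards counting negatively). Lemma. Let $\Gamma$ and $\Gamma'$ be bases and let $L,L'\in\mathbb N$. There are constants $\lambda\ge 1$, $\epsilon\ge 0$ and $C\ge 0$, depending only on $\Gamma$, $\Gamma'$ (with their height changes),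 $L$ and $L'$, such that for every admissible tree $V$ of valence at most $L$ over $\Gamma$ and every admissible tree $W$ of valence at most $L'$ over $\Gamma'$ there is a map $\phi$ from the vertices of $V$ to the vertices of $W$ which is a $(\lambda,\epsilon)$-quasi-isometry for the path metrics, that is, \[\tfrac1\lambda d_V(x,y)-\epsilon\le d_W(\phi(x),\phi(y))\le\lambda d_V(x,y)+\epsilon\] for all vertices $x,y$ of $V$ and every vertex of $W$ is within distance $\epsilon$ of the image of $\phi$, and which is $C$-coarsely height preserving, that is, $|h_W(\phi(x),\phi(y))-h_V(x,y)|\le C$ for all vertices $x,y$ of $V$. -/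

import Mathlib

universe u₁ u₂ u₃ u₄ u₅ u₆ u₇ u₈

/-- A graph with directed edges. Edges with equal endpoints and several edges with the same
endpoints are allowed. -/
structure DirGraph where
  Vert : Type u₁
  Edge : Type u₂
  src : Edge → Vert
  tgt : Edge → Vert

namespace DirGraph

/-- The simple graph obtained by forgetting directions, loops and multiplicities. Its connectedness
is connectedness of the graph, and its distance is the path metric with edges of length 1. -/
def toSimple (G : DirGraph.{u₁, u₂}) : SimpleGraph G.Vert where
  Adj u v := u ≠ v ∧ ∃ e, (G.src e = u ∧ G.tgt e = v) ∨ (G.src e = v ∧ G.tgt e = u)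
  symm := ⟨fun _ _ h => ⟨h.1.symm, h.2.imp fun _ h => h.symm⟩⟩
  loopless := ⟨fun _ h => h.1 rfl⟩

/-- The underlying undirected multigraph is a (nonempty) tree: it has no loops, no two edges with
the same pair of endpoints, and the resulting simple graph is a tree. -/
structure IsTree (G : DirGraph.{u₁, u₂}) : Prop where
  no_loop : ∀ e, G.src e ≠ G.tgt e
  no_multi : ∀ e f, s(G.src e, G.tgt e) = s(G.src f, G.tgt f) → e = f
  tree : G.toSimple.IsTree

/-- Every vertex has at most `L` incident edges. (For graphs without loops, this is a bound on
the valence.) -/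
def ValenceLE (G : DirGraph.{u₁, u₂}) (L : ℕ) : Prop :=
  ∀ v, {e | G.src e = v ∨ G.tgt e = v}.encard ≤ L

/-- `G.HeightChange h x y t`: there is an edge path from `x` to `y`, whose edges may be traversed in
either direction, such that the height changes across its edges sum up to `t`. Crossing the edge
`e` along its direction changes the height by `h e`, crossing it backwards by `- h e`. -/
inductive HeightChange (G : DirGraph.{u₁, u₂}) (h : G.Edge → ℝ) : G.Vert → G.Vert → ℝ → Prop
  | nil (x : G.Vert) : HeightChange G h x x 0
  | forward (e : G.Edge) {y : G.Vert} {t : ℝ} :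
      HeightChange G h (G.tgt e) y t → HeightChange G h (G.src e) y (h e + t)
  | backward (e : G.Edge) {y : G.Vert} {t : ℝ} :
      HeightChange G h (G.src e) y t → HeightChange G h (G.tgt e) y (-h e + t)

/-- A finite connected directed graph with a height change `h e` on each edge, such that some
loop has strictly positive total height change. -/
structure IsBase (G : DirGraph.{u₁, u₂}) (h : G.Edge → ℝ) : Prop where
  finite_vert : Finite G.Vert
  finite_edge : Finite G.Edge
  connected : G.toSimple.Connected
  exists_loop : ∃ v t, 0 < t ∧ G.HeightChange h v v t

/-- A morphism of directed graphs. -/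
structure Hom (V : DirGraph.{u₁, u₂}) (G : DirGraph.{u₃, u₄}) where
  onVert : V.Vert → G.Vert
  onEdge : V.Edge → G.Edge
  src_onEdge : ∀ e, G.src (onEdge e) = onVert (V.src e)
  tgt_onEdge : ∀ e, G.tgt (onEdge e) = onVert (V.tgt e)

/-- The height change of an edge upstairs is the height change of its image. -/
def Hom.lift {V : DirGraph.{u₁, u₂}} {G : DirGraph.{u₃, u₄}} (p : V.Hom G) (h : G.Edge → ℝ) :
    V.Edge → ℝ :=
  fun e => h (p.onEdge e)

/-- The number of edges coming in to `v` over an edge of the base. -/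
noncomputable def Hom.inCount {V : DirGraph.{u₁, u₂}} {G : DirGraph.{u₃, u₄}} (p : V.Hom G)
    (v : V.Vert) (e : G.Edge) : ℕ∞ :=
  {f | V.tgt f = v ∧ p.onEdge f = e}.encard

/-- The number of edges going out of `v` over an edge of the base. -/
noncomputable def Hom.outCount {V : DirGraph.{u₁, u₂}} {G : DirGraph.{u₃, u₄}} (p : V.Hom G)
    (v : V.Vert) (e : G.Edge) : ℕ∞ :=
  {f | V.src f = v ∧ p.onEdge f = e}.encard

open Classical in
/-- The number of times that the edge `e` has at least to be covered at each vertex: two, except that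
one suffices when `e` is a loop and the graph is not just a single vertex with a single edge. -/
noncomputable def requiredCount (G : DirGraph.{u₁, u₂}) (e : G.Edge) : ℕ∞ :=
  if G.src e = G.tgt e ∧ ¬ (Nat.card G.Vert = 1 ∧ Nat.card G.Edge = 1) then 1 else 2

/-- `V` is a tree with valence at most `L`, and at each of its vertices `v` the edges coming in to
(going out of) `v` cover each edge coming in to (going out of) `p v` at least as often as
required. -/
structure Hom.IsTreeCover {V : DirGraph.{u₁, u₂}} {G : DirGraph.{u₃, u₄}} (p : V.Hom G)
    (L : ℕ) : Prop where
  isTree : V.IsTree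
  valence : V.ValenceLE L
  incoming : ∀ v e, G.tgt e = p.onVert v → G.requiredCount e ≤ p.inCount v e
  outgoing : ∀ v e, G.src e = p.onVert v → G.requiredCount e ≤ p.outCount v e

/-- `φ` is a `(lam, ε)`-quasi-isometry of the vertex sets with their path metrics. -/
structure IsQuasiIsometry (V : DirGraph.{u₁, u₂}) (W : DirGraph.{u₃, u₄}) (lam ε : ℝ)
    (φ : V.Vert → W.Vert) : Prop where
  upper : ∀ x y, (W.toSimple.dist (φ x) (φ y) : ℝ) ≤ lam * V.toSimple.dist x y + ε
  lower : ∀ x y, lam⁻¹ * V.toSimple.dist x y - ε ≤ (W.toSimple.dist (φ x) (φ y) : ℝ)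
  coarsely_onto : ∀ w, ∃ x, (W.toSimple.dist (φ x) w : ℝ) ≤ ε

/-- The height change from `φ x` to `φ y` differs from that from `x` to `y` by at most `C`. (In a
tree the height change between two vertices exists and does not depend on the path.) -/
def IsCoarselyHeightPreserving (V : DirGraph.{u₁, u₂}) (W : DirGraph.{u₃, u₄})
    (hV : V.Edge → ℝ) (hW : W.Edge → ℝ) (C : ℝ) (φ : V.Vert → W.Vert) : Prop :=
  ∀ x y s t, V.HeightChange hV x y s → W.HeightChange hW (φ x) (φ y) t → |t - s| ≤ C

end DirGraph

/-!
Every admissible tree `V` is compared with one standard tree, the tree of words in four letters, in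
which each node has two children one level up and two children one level down. Levels are `A` apart,
where the scale `A` is a large constant that is chosen for both bases at once. The map from `V` to
`W` goes through the standard tree, and so does the map back, which is a coarse inverse.

Only one property of admissible trees is needed: after choosing a root, every vertex has, within a
bounded distance, a descendant that is higher by at least one and a descendant that is lower by at
least one (`DirGraph.IsBase.exists_climb`). It holds because every edge path of the base lifts to a
descending path of the tree, up to bounded detours around a loop whose only lift leads back towards
the root (`DirGraph.exists_reaches_of_edge`), and the base has loops with positive and with negative
height change. Trees with this property are called climbing trees here.

For a climbing tree, each node `s` of the standard tree gets a bunch of vertices, of bounded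
diameter and size, with heights close to the height of `s`. The root gets the root. Given the bunch at `s`,
its first member `x` is replaced by a cutset of the tree of descendants of `x`: the vertices at which
this tree leaves a window of heights around the height of `s`, or reaches a certain depth. As
branches of the tree lead up and down from everywhere, at least two vertices of the cutset lie beyond
the top of the window and two beyond the bottom (`ClimbingTree.exists_two_mem_cutset_above`). Now the
old members of the bunch and the vertices of the cutset are distributed to the two upper and the two
lower children of `s`, the higher ones to the upper children and the lower ones to the lower
children. Two children in each direction make it possible to keep old members apart from new ones,
so that each bunch is a part of a single cutset, which bounds its diameter and its size
(`ClimbingTree.isBunch_bunch`), and an old member has to wait only for a bounded number of steps until it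
is replaced in its turn (`ClimbingTree.exists_vertexAt_eq`).

Every vertex of the tree is passed at exactly one node (`ClimbingTree.exists_passedAt`,
`ClimbingTree.PassedAt.unique`), adjacent vertices are passed at nodes at a bounded distance
(`ClimbingTree.nodeOf_eq_append`), and the first members of the bunches at neighbouring nodes are
close to each other (`ClimbingTree.dist_vertexAt_cons`). This gives Lipschitz maps in both directions
between the tree and the standard tree, which are coarsely inverse to each other and preserve heights
up to a constant.
-/

/-! ### Ancestors in rooted trees -/

namespace SimpleGraph

variable {X : Type*} {G : SimpleGraph X} {o x y z w : X}

/-- In the graph `G` rooted at `o`, the vertex `x` lies on a geodesic from the root to `y`. The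
definition is purely metric, which makes transitivity a matter of the triangle inequality. -/
def IsAncestor (G : SimpleGraph X) (o x y : X) : Prop :=
  G.dist o y = G.dist o x + G.dist x y

theorem isAncestor_refl (G : SimpleGraph X) (o x : X) : G.IsAncestor o x x := by
  simp [IsAncestor]

theorem isAncestor_root (G : SimpleGraph X) (o x : X) : G.IsAncestor o o x := by
  simp [IsAncestor]

theorem IsAncestor.trans (hG : G.Connected) (hxy : G.IsAncestor o x y)
    (hyz : G.IsAncestor o y z) : G.IsAncestor o x z := by
  have h₁ := hG.dist_triangle (u := x) (v := y) (w := z)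
  have h₂ := hG.dist_triangle (u := o) (v := x) (w := z)
  unfold IsAncestor at *
  omega

/-- Distances add up along a chain of ancestors. -/
theorem IsAncestor.dist_add (hG : G.Connected) (hxy : G.IsAncestor o x y)
    (hyz : G.IsAncestor o y z) : G.dist x z = G.dist x y + G.dist y z := by
  have h := hxy.trans hG hyz
  unfold IsAncestor at *
  omega

theorem IsAncestor.eq_or_dist_lt (hG : G.Connected) (h : G.IsAncestor o x y) :
    x = y ∨ G.dist o x < G.dist o y := by
  unfold IsAncestor at h
  rcases Nat.eq_zero_or_pos (G.dist x y) with h0 | h0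
  · exact Or.inl (hG.dist_eq_zero_iff.1 h0)
  · omega

theorem isAncestor_of_adj (hxy : G.Adj x y) (h : G.dist o y = G.dist o x + 1) :
    G.IsAncestor o x y := by
  unfold IsAncestor
  rw [h, dist_eq_one_iff_adj.2 hxy]

theorem Connected.exists_adj_dist_eq (hG : G.Connected) {n : ℕ} (h : G.dist x y = n + 1) :
    ∃ w, G.Adj x w ∧ G.dist w y = n := by
  obtain ⟨p, hp⟩ := hG.exists_walk_length_eq_dist x y
  cases p with
  | nil => simp at h
  | cons hadj p =>
    rename_i w
    refine ⟨w, hadj, ?_⟩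
    have h₁ := dist_le p
    have h₂ := hG.dist_triangle (u := x) (v := w) (w := y)
    rw [dist_eq_one_iff_adj.2 hadj] at h₂
    simp only [Walk.length_cons] at hp
    omega

/-- A proper descendant of `x` is a descendant of a child of `x`. -/
theorem IsAncestor.exists_child (hG : G.Connected) (h : G.IsAncestor o x y) (hne : x ≠ y) :
    ∃ w, G.Adj x w ∧ G.dist o w = G.dist o x + 1 ∧ G.IsAncestor o w y := by
  have hpos := hG.pos_dist_of_ne hne
  obtain ⟨n, hn⟩ : ∃ n, G.dist x y = n + 1 := ⟨G.dist x y - 1, by omega⟩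
  obtain ⟨w, hw, hwn⟩ := hG.exists_adj_dist_eq hn
  have h₁ := hG.dist_triangle (u := o) (v := w) (w := y)
  have h₂ := hG.dist_triangle (u := o) (v := x) (w := w)
  rw [dist_eq_one_iff_adj.2 hw] at h₂
  unfold IsAncestor at *
  exact ⟨w, hw, by omega, by omega⟩

/-- A proper ancestor of `y` is an ancestor of a parent of `y`. -/
theorem IsAncestor.exists_parent (hG : G.Connected) (h : G.IsAncestor o x y) (hne : x ≠ y) :
    ∃ w, G.Adj w y ∧ G.dist o y = G.dist o w + 1 ∧ G.IsAncestor o x w := by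
  have hpos := hG.pos_dist_of_ne hne
  obtain ⟨n, hn⟩ : ∃ n, G.dist y x = n + 1 := ⟨G.dist x y - 1, by rw [dist_comm]; omega⟩
  obtain ⟨w, hw, hwn⟩ := hG.exists_adj_dist_eq hn
  have h₁ := hG.dist_triangle (u := o) (v := x) (w := w)
  have h₂ := hG.dist_triangle (u := o) (v := w) (w := y)
  rw [dist_eq_one_iff_adj.2 hw.symm] at h₂
  rw [dist_comm] at hn hwn
  unfold IsAncestor at *
  exact ⟨w, hw.symm, by omega, by omega⟩

/-- In a tree, a vertex has at most one neighbour that is closer to the root. -/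
theorem IsTree.parent_unique (hG : G.IsTree) (hx : G.Adj x z) (hy : G.Adj y z)
    (hxd : G.dist o z = G.dist o x + 1) (hyd : G.dist o z = G.dist o y + 1) : x = y := by
  obtain ⟨p, hp⟩ := hG.connected.exists_walk_length_eq_dist o x
  obtain ⟨q, hq⟩ := hG.connected.exists_walk_length_eq_dist o y
  have hp' : (p.concat hx).IsPath :=
    Walk.isPath_of_length_eq_dist _ (by rw [Walk.length_concat, hp, hxd])
  have hq' : (q.concat hy).IsPath :=
    Walk.isPath_of_length_eq_dist _ (by rw [Walk.length_concat, hq, hyd])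
  have h := congrArg Subtype.val
    ((isAcyclic_iff_subsingleton_path.1 hG.isAcyclic o z).elim ⟨_, hp'⟩ ⟨_, hq'⟩)
  simpa using congrArg Walk.penultimate h

/-- In a tree, a vertex has at most one ancestor at each distance from the root: subtrees hanging
from different vertices of the same level are disjoint. -/
theorem IsTree.ancestor_unique (hG : G.IsTree) (hx : G.IsAncestor o x z)
    (hy : G.IsAncestor o y z) (h : G.dist o x = G.dist o y) : x = y := by
  induction hn : G.dist o z using Nat.strong_induction_on generalizing z with
  | _ n ih =>
    by_cases hxz : x = z
    · subst hxz
      rcases hy.eq_or_dist_lt hG.connected with h' | h'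
      · exact h'.symm
      · omega
    by_cases hyz : y = z
    · subst hyz
      rcases hx.eq_or_dist_lt hG.connected with h' | h'
      · exact h'
      · omega
    obtain ⟨u, hu, hud, hxu⟩ := hx.exists_parent hG.connected hxz
    obtain ⟨v, hv, hvd, hyv⟩ := hy.exists_parent hG.connected hyz
    obtain rfl := hG.parent_unique hu hv hud hvd
    exact ih _ (by omega) hxu hyv rfl

/-- The parent of `z` lies below every proper ancestor of `z`. -/
theorem IsTree.isAncestor_parent (hG : G.IsTree) (hx : G.IsAncestor o x z) (hne : x ≠ z)
    (hy : G.Adj y z) (hyd : G.dist o z = G.dist o y + 1) : G.IsAncestor o x y := by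
  obtain ⟨u, hu, hud, hxu⟩ := hx.exists_parent hG.connected hne
  rwa [hG.parent_unique hy hu hyd hud]

theorem Connected.abs_sub_le_mul_dist (hG : G.Connected) {H : X → ℝ} {K : ℝ}
    (h : ∀ x y, G.Adj x y → |H y - H x| ≤ K) (x y : X) : |H y - H x| ≤ K * G.dist x y := by
  obtain ⟨p, hp⟩ := hG.exists_walk_length_eq_dist x y
  rw [← hp]
  clear hp
  induction p with
  | nil => simp
  | cons hadj p ih =>
    have h' := h _ _ hadj
    rw [abs_le] at *
    push_cast [Walk.length_cons]
    constructor <;> linarith [ih.1, ih.2, h'.1, h'.2]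

theorem Connected.dist_map_le_mul_dist (hG : G.Connected) {Y : Type*} {G' : SimpleGraph Y}
    (hG' : G'.Connected) {φ : X → Y} {n : ℕ}
    (h : ∀ x y, G.Adj x y → G'.dist (φ x) (φ y) ≤ n) (x y : X) :
    G'.dist (φ x) (φ y) ≤ n * G.dist x y := by
  obtain ⟨p, hp⟩ := hG.exists_walk_length_eq_dist x y
  rw [← hp]
  clear hp
  induction p with
  | nil => simp
  | cons hadj p ih =>
    rename_i u v w
    have h' := h _ _ hadj
    have h'' := hG'.dist_triangle (u := φ u) (v := φ v) (w := φ w)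
    rw [Walk.length_cons, mul_add, mul_one]
    omega

end SimpleGraph

/-! ### Trees in which every vertex has ascending and descending descendants -/

/-- A rooted tree with a height function in which every vertex has at most `L` children, heights
of neighbours differ by at most `K`, and among the descendants of each vertex at distance at most
`ℓ` some are higher by at least one and some are lower by at least one. -/
structure ClimbingTree (X : Type*) (L ℓ : ℕ) (K : ℝ) where
  graph : SimpleGraph X
  isTree : graph.IsTree
  root : X
  height : X → ℝ
  children : X → List X
  mem_children : ∀ {x y}, y ∈ children x ↔
    graph.Adj x y ∧ graph.dist root y = graph.dist root x + 1
  nodup_children : ∀ x, (children x).Nodup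
  length_children : ∀ x, (children x).length ≤ L
  nonneg : 0 ≤ K
  abs_height_sub : ∀ x y, graph.Adj x y → |height y - height x| ≤ K
  ascend : ∀ x, ∃ y, graph.IsAncestor root x y ∧ graph.dist x y ≤ ℓ ∧ height x + 1 ≤ height y
  descend : ∀ x, ∃ y, graph.IsAncestor root x y ∧ graph.dist x y ≤ ℓ ∧ height y ≤ height x - 1

/-- Follow the branches of the tree of descendants of `y`, as long as the vertices satisfy `P`
and for at most `k` steps, and list the vertices at which this stops. -/
noncomputable def cutset {X : Type*} (children : X → List X) (P : X → Prop) : ℕ → X → List X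
  | 0, y => [y]
  | k + 1, y => open Classical in
    if P y then (children y).flatMap (cutset children P k) else [y]

namespace ClimbingTree

variable {X : Type*} {L ℓ : ℕ} {K : ℝ} (T : ClimbingTree X L ℓ K)

/-- `x` is an ancestor of `y` or equal to it. -/
abbrev Anc (x y : X) : Prop := T.graph.IsAncestor T.root x y

/-- The subtrees of descendants of `x` and `y` are disjoint. -/
def DisjointBelow (x y : X) : Prop := ∀ z, T.Anc x z → ¬ T.Anc y z

variable {T}

theorem connected : T.graph.Connected := T.isTree.connected

theorem Anc.trans {x y z : X} (h : T.Anc x y) (h' : T.Anc y z) : T.Anc x z :=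
  SimpleGraph.IsAncestor.trans connected h h'

theorem anc_of_mem_children {x y : X} (h : y ∈ T.children x) : T.Anc x y :=
  SimpleGraph.isAncestor_of_adj (T.mem_children.1 h).1 (T.mem_children.1 h).2

theorem not_anc_of_mem_children {x y : X} (h : y ∈ T.children x) : ¬ T.Anc y x := by
  intro h'
  have h₁ := (T.mem_children.1 h).2
  unfold Anc SimpleGraph.IsAncestor at h'
  omega

theorem dist_of_mem_children {x y : X} (h : y ∈ T.children x) : T.graph.dist x y = 1 :=
  SimpleGraph.dist_eq_one_iff_adj.2 (T.mem_children.1 h).1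

theorem abs_height_sub_le_mul_dist (x y : X) :
    |T.height y - T.height x| ≤ K * T.graph.dist x y :=
  connected.abs_sub_le_mul_dist T.abs_height_sub x y

theorem abs_height_sub_le_mul {x y : X} {n : ℕ} (h : T.graph.dist x y ≤ n) :
    |T.height y - T.height x| ≤ K * n :=
  (abs_height_sub_le_mul_dist x y).trans
    (mul_le_mul_of_nonneg_left (by exact_mod_cast h) T.nonneg)

theorem pairwise_children (x : X) : (T.children x).Pairwise T.DisjointBelow := by
  refine (T.nodup_children x).imp_of_mem fun {a b} ha hb hne z hz hz' => hne ?_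
  exact T.isTree.ancestor_unique hz hz'
    (((T.mem_children.1 ha).2).trans (T.mem_children.1 hb).2.symm)

instance : Std.Symm T.DisjointBelow := ⟨fun _ _ h z hz hz' => h z hz' hz⟩

theorem DisjointBelow.mono {x y x' y' : X} (h : T.DisjointBelow x y) (hx : T.Anc x x')
    (hy : T.Anc y y') : T.DisjointBelow x' y' :=
  fun z hz hz' => h z (hx.trans hz) (hy.trans hz')

theorem DisjointBelow.ne {x y : X} (h : T.DisjointBelow x y) : x ≠ y := by
  rintro rfl
  exact h x (SimpleGraph.isAncestor_refl _ _ _) (SimpleGraph.isAncestor_refl _ _ _)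

variable (T) in
/-- The same tree upside down. -/
def neg : ClimbingTree X L ℓ K where
  __ := T
  height x := - T.height x
  abs_height_sub x y h := by
    have := T.abs_height_sub x y h
    rwa [neg_sub_neg, abs_sub_comm]
  ascend x := by
    obtain ⟨y, h₁, h₂, h₃⟩ := T.descend x
    exact ⟨y, h₁, h₂, by linarith⟩
  descend x := by
    obtain ⟨y, h₁, h₂, h₃⟩ := T.ascend x
    exact ⟨y, h₁, h₂, by linarith⟩

/-! ### Cutsets -/

section Cutset

variable {P : X → Prop}

theorem mem_cutset_of_not {k : ℕ} {y : X} (h : ¬ P y) : y ∈ cutset T.children P k y := by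
  cases k <;> simp [cutset, h]

theorem mem_cutset_succ {k : ℕ} {y z : X} (h : P y) :
    z ∈ cutset T.children P (k + 1) y ↔ ∃ w ∈ T.children y, z ∈ cutset T.children P k w := by
  simp [cutset, h]

theorem anc_of_mem_cutset {k : ℕ} {y z : X} (hz : z ∈ cutset T.children P k y) :
    T.Anc y z ∧ T.graph.dist y z ≤ k := by
  induction k generalizing y with
  | zero =>
    obtain rfl : z = y := by simpa [cutset] using hz
    exact ⟨SimpleGraph.isAncestor_refl _ _ _, by simp⟩
  | succ k ih =>
    by_cases hP : P y
    · obtain ⟨w, hw, hzw⟩ := (mem_cutset_succ hP).1 hz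
      have h := ih hzw
      have hyw := anc_of_mem_children hw
      refine ⟨hyw.trans h.1, ?_⟩
      rw [SimpleGraph.IsAncestor.dist_add connected hyw h.1, dist_of_mem_children hw]
      omega
    · obtain rfl : z = y := by simpa [cutset, hP] using hz
      exact ⟨SimpleGraph.isAncestor_refl _ _ _, by simp⟩

theorem not_anc_of_mem_cutset {k : ℕ} {y z : X} (hP : P y)
    (hz : z ∈ cutset T.children P (k + 1) y) : ¬ T.Anc z y := by
  obtain ⟨w, hw, hzw⟩ := (mem_cutset_succ hP).1 hz
  exact fun h => not_anc_of_mem_children hw ((anc_of_mem_cutset hzw).1.trans h)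

theorem pairwise_cutset (k : ℕ) (y : X) :
    (cutset T.children P k y).Pairwise T.DisjointBelow := by
  induction k generalizing y with
  | zero => simp [cutset]
  | succ k ih =>
    by_cases hP : P y
    · simp only [cutset, hP, if_true]
      rw [List.pairwise_flatMap]
      refine ⟨fun w _ => ih w, (pairwise_children y).imp fun {a b} hab u hu v hv => ?_⟩
      exact hab.mono (anc_of_mem_cutset hu).1 (anc_of_mem_cutset hv).1
    · simp [cutset, hP]

theorem length_cutset_le (k : ℕ) (y : X) :
    (cutset T.children P k y).length ≤ (L + 1) ^ k := by
  induction k generalizing y with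
  | zero => simp [cutset]
  | succ k ih =>
    by_cases hP : P y
    · simp only [cutset, hP, if_true, List.length_flatMap]
      calc ((T.children y).map fun w => (cutset T.children P k w).length).sum
          ≤ ((T.children y).map fun w => (cutset T.children P k w).length).length •
              (L + 1) ^ k := List.sum_le_card_nsmul _ _ (by simpa using fun w _ => ih w)
        _ ≤ (L + 1) ^ (k + 1) := by
            rw [List.length_map, smul_eq_mul, pow_succ']
            exact Nat.mul_le_mul_right _ ((T.length_children y).trans (Nat.le_succ L))
    · simp [cutset, hP, Nat.one_le_pow]

/-- Every branch runs into the cutset within `k` steps. -/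
theorem dist_le_or_below_cutset {k : ℕ} {y z : X} (h : T.Anc y z) :
    T.graph.dist y z ≤ k ∨ ∃ t ∈ cutset T.children P k y, T.Anc t z := by
  induction k generalizing y with
  | zero => exact Or.inr ⟨y, by simp [cutset], h⟩
  | succ k ih =>
    by_cases hP : P y
    · by_cases hyz : y = z
      · subst hyz
        simp
      obtain ⟨w, hyw, hd, hwz⟩ := SimpleGraph.IsAncestor.exists_child connected h hyz
      have hw : w ∈ T.children y := T.mem_children.2 ⟨hyw, hd⟩
      rcases ih hwz with h' | ⟨t, ht, htz⟩
      · left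
        rw [SimpleGraph.IsAncestor.dist_add connected (anc_of_mem_children hw) hwz,
          dist_of_mem_children hw]
        omega
      · exact Or.inr ⟨t, (mem_cutset_succ hP).2 ⟨w, hw, ht⟩, htz⟩
    · exact Or.inr ⟨y, mem_cutset_of_not hP, h⟩

/-- Unless the path from `y` to `u` leaves the region `P`, the cutset of `u` is a part of the
cutset of `y`. -/
theorem exit_or_cutset_subset {k : ℕ} {y u : X} (h : T.Anc y u) (hk : T.graph.dist y u ≤ k) :
    (∃ z ∈ cutset T.children P k y, ¬ P z ∧ T.Anc y z ∧ T.Anc z u) ∨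
      cutset T.children P (k - T.graph.dist y u) u ⊆ cutset T.children P k y := by
  induction k generalizing y with
  | zero =>
    obtain rfl := connected.dist_eq_zero_iff.1 (Nat.le_zero.1 hk)
    simp
  | succ k ih =>
    by_cases hP : P y
    · by_cases hyu : y = u
      · subst hyu
        simp
      obtain ⟨w, hyw, hd, hwu⟩ := SimpleGraph.IsAncestor.exists_child connected h hyu
      have hw : w ∈ T.children y := T.mem_children.2 ⟨hyw, hd⟩
      have hdist : T.graph.dist y u = 1 + T.graph.dist w u := by
        rw [SimpleGraph.IsAncestor.dist_add connected (anc_of_mem_children hw) hwu,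
          dist_of_mem_children hw]
      rcases ih hwu (by omega) with ⟨z, hz, hPz, hwz, hzu⟩ | h'
      · exact Or.inl ⟨z, (mem_cutset_succ hP).2 ⟨w, hw, hz⟩, hPz,
          (anc_of_mem_children hw).trans hwz, hzu⟩
      · right
        intro v hv
        refine (mem_cutset_succ hP).2 ⟨w, hw, h' ?_⟩
        rwa [show k - T.graph.dist w u = k + 1 - T.graph.dist y u by omega]
    · exact Or.inl ⟨y, mem_cutset_of_not hP, hP, SimpleGraph.isAncestor_refl _ _ _, h⟩

variable {c R : ℝ}

theorem abs_height_sub_le_of_mem_cutset (hP : ∀ y, P y ↔ |T.height y - c| < R) {k : ℕ} {y z : X}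
    (hy : |T.height y - c| ≤ R + K) (hz : z ∈ cutset T.children P k y) :
    |T.height z - c| ≤ R + K := by
  induction k generalizing y with
  | zero =>
    obtain rfl : z = y := by simpa [cutset] using hz
    exact hy
  | succ k ih =>
    by_cases hPy : P y
    · obtain ⟨w, hw, hzw⟩ := (mem_cutset_succ hPy).1 hz
      refine ih ?_ hzw
      have h₁ := (hP y).1 hPy
      have h₂ := T.abs_height_sub _ _ (T.mem_children.1 hw).1
      rw [abs_le] at *
      rw [abs_lt] at h₁
      constructor <;> linarith [h₁.1, h₁.2, h₂.1, h₂.2]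
    · obtain rfl : z = y := by simpa [cutset, hPy] using hz
      exact hy

/-- A vertex that is not too close to the bottom of the window of heights `c - R < t < c + R` has
a descendant at which the tree leaves the window through its top. -/
theorem exists_mem_cutset_above (hP : ∀ y, P y ↔ |T.height y - c| < R) (j : ℕ) {k : ℕ} {y : X}
    (hlow : c - R + K * ℓ < T.height y) (htop : c + R - j ≤ T.height y) (hk : j * ℓ ≤ k) :
    ∃ z ∈ cutset T.children P k y, c + R ≤ T.height z := by
  induction j generalizing y k with
  | zero =>
    refine ⟨y, mem_cutset_of_not ?_, by simpa using htop⟩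
    rw [hP, not_lt]
    have h : c + R ≤ T.height y := by simpa using htop
    exact (by linarith : R ≤ T.height y - c).trans (le_abs_self _)
  | succ j ih =>
    obtain ⟨u, hyu, hd, hu⟩ := T.ascend y
    push_cast at htop
    rw [Nat.succ_mul] at hk
    rcases exit_or_cutset_subset (P := P) hyu (show T.graph.dist y u ≤ k by omega) with
      ⟨z, hz, hPz, hyz, hzu⟩ | h
    · refine ⟨z, hz, ?_⟩
      -- the height drops by at most `K * ℓ` on the way to `u`, so the exit is not at the bottom
      have hdz : T.graph.dist y z ≤ ℓ := by
        rw [SimpleGraph.IsAncestor.dist_add connected hyz hzu] at hd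
        omega
      have h₁ := abs_le.1 (abs_height_sub_le_mul hdz)
      rw [hP, not_lt, le_abs] at hPz
      rcases hPz with h₂ | h₂ <;> linarith [h₁.1]
    · obtain ⟨z, hz, hzt⟩ := ih (k := k - T.graph.dist y u) (y := u) (by linarith) (by linarith)
        (by omega)
      exact ⟨z, h hz, hzt⟩

theorem exists_mem_cutset_below (hP : ∀ y, P y ↔ |T.height y - c| < R) (j : ℕ) {k : ℕ} {y : X}
    (htop : T.height y < c + R - K * ℓ) (hlow : T.height y ≤ c - R + j) (hk : j * ℓ ≤ k) :
    ∃ z ∈ cutset T.children P k y, T.height z ≤ c - R := by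
  obtain ⟨z, hz, h⟩ := exists_mem_cutset_above (T := T.neg) (P := P) (c := -c) (R := R)
    (fun y => by
      change P y ↔ |-T.height y - -c| < R
      rw [hP, neg_sub_neg, abs_sub_comm]) j (k := k) (y := y)
    (show _ < -T.height y by linarith) (show _ ≤ -T.height y by linarith) hk
  exact ⟨z, hz, by have : -c + R ≤ -T.height z := h; linarith⟩

end Cutset

/-- Within this distance, every vertex of a climbing tree has two incomparable descendants. -/
noncomputable def splitDepth (ℓ : ℕ) (K : ℝ) : ℕ := ⌈K * ℓ + 1⌉₊ * ℓ

/-- One of the two descendants is where the tree leaves a window of heights through the top,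
the other one where it leaves the window through the bottom. -/
theorem exists_disjointBelow (x : X) : ∃ y z, T.Anc x y ∧ T.Anc x z ∧ T.DisjointBelow y z ∧
    T.graph.dist x y ≤ splitDepth ℓ K ∧ T.graph.dist x z ≤ splitDepth ℓ K := by
  have hR := Nat.le_ceil (K * ℓ + 1)
  have hK : 0 ≤ K * ℓ := mul_nonneg T.nonneg (Nat.cast_nonneg _)
  obtain ⟨y, hy, hyt⟩ := exists_mem_cutset_above (T := T)
    (P := fun y => |T.height y - T.height x| < K * ℓ + 1) (fun _ => Iff.rfl)
    ⌈K * ℓ + 1⌉₊ (k := splitDepth ℓ K) (y := x) (by linarith) (by linarith) le_rfl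
  obtain ⟨z, hz, hzt⟩ := exists_mem_cutset_below (T := T)
    (P := fun y => |T.height y - T.height x| < K * ℓ + 1) (fun _ => Iff.rfl)
    ⌈K * ℓ + 1⌉₊ (k := splitDepth ℓ K) (y := x) (by linarith) (by linarith) le_rfl
  have hne : y ≠ z := by
    rintro rfl
    linarith
  exact ⟨y, z, (anc_of_mem_cutset hy).1, (anc_of_mem_cutset hz).1,
    (pairwise_cutset _ _).forall hy hz hne,
    (anc_of_mem_cutset hy).2, (anc_of_mem_cutset hz).2⟩

/-- The smallest difference of heights between adjacent levels with which the construction works. -/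
noncomputable def minScale (ℓ : ℕ) (K : ℝ) : ℝ := K * (splitDepth ℓ K + ℓ + 1) + 1

/-- The depth to which trees of descendants are cut off. -/
noncomputable def cutDepth (ℓ : ℕ) (K A : ℝ) : ℕ := splitDepth ℓ K + ⌈6 * A⌉₊ * ℓ + 1

/-- The vertices whose heights differ from `c` by less than `3 * A - K`. -/
def Window (T : ClimbingTree X L ℓ K) (A c : ℝ) (y : X) : Prop := |T.height y - c| < 3 * A - K

variable {A : ℝ}

/-- A vertex in the middle part of the window has two descendants at which the tree leaves the
window through its top. -/
theorem exists_two_mem_cutset_above (hA : minScale ℓ K ≤ A) {c : ℝ} {x : X}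
    (hx : |T.height x - c| ≤ 2 * A) :
    ∃ z ∈ cutset T.children (T.Window A c) (cutDepth ℓ K A) x,
    ∃ z' ∈ cutset T.children (T.Window A c) (cutDepth ℓ K A) x,
      z ≠ z' ∧ c + (3 * A - K) ≤ T.height z ∧ c + (3 * A - K) ≤ T.height z' := by
  have hK := T.nonneg
  have hKℓ : 0 ≤ K * ℓ := mul_nonneg hK (Nat.cast_nonneg _)
  have hKs : 0 ≤ K * splitDepth ℓ K := mul_nonneg hK (Nat.cast_nonneg _)
  have hA' : K * splitDepth ℓ K + K * ℓ + K + 1 ≤ A := by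
    unfold minScale at hA
    linarith
  rw [abs_le] at hx
  -- the ascent from a nearby descendant `y` of `x`
  have key : ∀ y, T.Anc x y → T.graph.dist x y ≤ splitDepth ℓ K →
      ∃ z ∈ cutset T.children (T.Window A c) (cutDepth ℓ K A) x, T.Anc y z ∧
        c + (3 * A - K) ≤ T.height z := by
    intro y hxy hd
    have hj := Nat.le_ceil (6 * A)
    have hy := abs_le.1 (abs_height_sub_le_mul hd)
    obtain ⟨z, hz, hzt⟩ := exists_mem_cutset_above (T := T) (P := T.Window A c) (c := c)
      (R := 3 * A - K) (fun _ => Iff.rfl) ⌈6 * A⌉₊ (k := cutDepth ℓ K A - T.graph.dist x y) (y := y)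
      (by linarith [hx.1, hy.1]) (by linarith [hx.1, hy.1]) (by unfold cutDepth; omega)
    refine ⟨z, ?_, (anc_of_mem_cutset hz).1, hzt⟩
    rcases exit_or_cutset_subset (P := T.Window A c) (k := cutDepth ℓ K A) hxy
      (by unfold cutDepth; omega) with ⟨w, -, hw, hxw, hwy⟩ | h
    · exfalso
      have hdw : T.graph.dist x w ≤ splitDepth ℓ K := by
        rw [SimpleGraph.IsAncestor.dist_add connected hxw hwy] at hd
        omega
      have hw' := abs_le.1 (abs_height_sub_le_mul hdw)
      refine hw (abs_lt.2 ⟨?_, ?_⟩) <;> linarith [hx.1, hx.2, hw'.1, hw'.2]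
    · exact h hz
  obtain ⟨y, y', hy, hy', hdisj, hd, hd'⟩ := exists_disjointBelow (T := T) x
  obtain ⟨z, hz, hyz, h⟩ := key y hy hd
  obtain ⟨z', hz', hyz', h'⟩ := key y' hy' hd'
  exact ⟨z, hz, z', hz', (hdisj.mono hyz hyz').ne, h, h'⟩

theorem exists_two_mem_cutset_below (hA : minScale ℓ K ≤ A) {c : ℝ} {x : X}
    (hx : |T.height x - c| ≤ 2 * A) :
    ∃ z ∈ cutset T.children (T.Window A c) (cutDepth ℓ K A) x,
    ∃ z' ∈ cutset T.children (T.Window A c) (cutDepth ℓ K A) x,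
      z ≠ z' ∧ T.height z ≤ c - (3 * A - K) ∧ T.height z' ≤ c - (3 * A - K) := by
  have hW : T.neg.Window A (-c) = T.Window A c := by
    funext y
    change (|-T.height y - -c| < _) = (|T.height y - c| < _)
    rw [neg_sub_neg, abs_sub_comm]
  obtain ⟨z, hz, z', hz', hne, h, h'⟩ := exists_two_mem_cutset_above (T := T.neg) hA
    (c := -c) (x := x) (by
      change |-T.height x - -c| ≤ _
      rwa [neg_sub_neg, abs_sub_comm])
  rw [hW] at hz hz'
  change _ ≤ -T.height z at h
  change _ ≤ -T.height z' at h'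
  exact ⟨z, hz, z', hz', hne, by linarith, by linarith⟩

end ClimbingTree

/-! ### Parametrizing a climbing tree by a standard tree -/

/-- Distribute the elements of two lists to two lists, without mixing. Two nonempty lists are kept
as they are; if the first list is empty, then the first element of the second list is split off. -/
def splitLists {X : Type*} : List X → List X → Bool → List X
  | [], new, i => bif i then new.take 1 else new.drop 1
  | x :: old, new, i => bif i then x :: old else new

section splitLists

variable {X : Type*} {old new : List X} {y : X}

theorem splitLists_sublist (old new : List X) (i : Bool) :
    (splitLists old new i).Sublist old ∨ (splitLists old new i).Sublist new := by
  cases old <;> cases i <;> simp [splitLists, List.take_sublist, List.tail_sublist]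

theorem splitLists_ne_nil (h : 2 ≤ new.length) (i : Bool) : splitLists old new i ≠ [] := by
  intro h0
  have h1 := congrArg List.length h0
  cases old <;> cases i <;>
    simp only [splitLists, cond_true, cond_false, List.length_take, List.length_drop,
      List.length_cons, List.length_nil] at h1 <;> omega

theorem splitLists_true_of_mem (h : y ∈ old) : splitLists old new true = old := by
  cases old with
  | nil => simp at h
  | cons x old => rfl

theorem exists_mem_splitLists (h : y ∈ new) : ∃ i, y ∈ splitLists old new i := by
  cases old with
  | nil =>
    rw [← List.take_append_drop 1 new, List.mem_append] at h
    rcases h with h | h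
    · exact ⟨true, h⟩
    · exact ⟨false, h⟩
  | cons x old => exact ⟨false, h⟩

theorem rel_of_mem_splitLists {r : X → X → Prop} (h : (old ++ new).Pairwise r) {a b : X}
    (ha : a ∈ splitLists old new true) (hb : b ∈ splitLists old new false) : r a b := by
  cases old with
  | nil =>
    rw [List.nil_append, ← List.take_append_drop 1 new, List.pairwise_append] at h
    exact h.2.2 a ha b hb
  | cons x old => exact (List.pairwise_append.1 h).2.2 a ha b hb

end splitLists

theorem List.two_le_length_of_mem {X : Type*} {l : List X} {a b : X} (ha : a ∈ l) (hb : b ∈ l)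
    (h : a ≠ b) : 2 ≤ l.length := by
  match l with
  | [] => simp at ha
  | [x] =>
    rw [List.mem_singleton] at ha hb
    exact absurd (ha.trans hb.symm) h
  | _ :: _ :: _ => simp

/-- The standard tree is the tree of words in four letters, a word being a child of its tail. Two of
the letters go up by one level, the other two go down. -/
def level : List (Bool × Bool) → ℝ
  | [] => 0
  | (b, _) :: s => (bif b then 1 else -1) + level s

namespace ClimbingTree

variable {X : Type*} {L ℓ : ℕ} {K A : ℝ}

/-- The height that corresponds to the node `s` of the standard tree. -/
noncomputable def center (T : ClimbingTree X L ℓ K) (A : ℝ) (s : List (Bool × Bool)) : ℝ :=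
  T.height T.root + A * level s

/-- The members of `l` of height at least `c`, or those of smaller height. -/
noncomputable def side (T : ClimbingTree X L ℓ K) (c : ℝ) (b : Bool) (l : List X) : List X :=
  l.filter fun y => decide (c ≤ T.height y) = b

/-- The cutset below `x` that belongs to the node `s` of the standard tree. -/
noncomputable def nodeCutset (T : ClimbingTree X L ℓ K) (A : ℝ) (s : List (Bool × Bool)) (x : X) :
    List X :=
  cutset T.children (T.Window A (T.center A s)) (cutDepth ℓ K A) x

/-- The vertices whose trees of descendants make up the part of the tree that corresponds to the
tree of descendants of `s` in the standard tree. The first of them is replaced by a cutset; the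
others and the vertices of the cutset are distributed to the four children of `s`, according to
their heights and without mixing the others with the vertices of the cutset. -/
noncomputable def bunch (T : ClimbingTree X L ℓ K) (A : ℝ) : List (Bool × Bool) → List X
  | [] => [T.root]
  | (b, i) :: s => match bunch T A s with
    | [] => []
    | x :: old => splitLists (T.side (T.center A s) b old)
        (T.side (T.center A s) b (T.nodeCutset A s x)) i

variable {T : ClimbingTree X L ℓ K}

theorem mem_side {c : ℝ} {b : Bool} {l : List X} {y : X} :
    y ∈ T.side c b l ↔ y ∈ l ∧ decide (c ≤ T.height y) = b := by
  simp [side]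

theorem side_sublist (c : ℝ) (b : Bool) (l : List X) : (T.side c b l).Sublist l :=
  List.filter_sublist

/-- What the bunch of vertices at the node `s` satisfies. As a bunch is a part of a single
cutset, both its diameter and its size are bounded independently of `s`. -/
structure IsBunch (T : ClimbingTree X L ℓ K) (A : ℝ) (s : List (Bool × Bool)) (l : List X) :
    Prop where
  ne_nil : l ≠ []
  abs_height_sub_le : ∀ y ∈ l, |T.height y - T.center A s| ≤ 2 * A
  pairwise : l.Pairwise T.DisjointBelow
  near : ∃ x, ∀ y ∈ l, T.graph.dist x y ≤ cutDepth ℓ K A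
  length_le : l.length ≤ (L + 1) ^ cutDepth ℓ K A

theorem pos_of_minScale_le (T : ClimbingTree X L ℓ K) (hA : minScale ℓ K ≤ A) :
    0 < A ∧ K < A := by
  have h₁ : 0 ≤ K * splitDepth ℓ K := mul_nonneg T.nonneg (Nat.cast_nonneg _)
  have h₂ : 0 ≤ K * ℓ := mul_nonneg T.nonneg (Nat.cast_nonneg _)
  have h₃ := T.nonneg
  unfold minScale at hA
  constructor <;> linarith

theorem window_of_abs_le (hA : minScale ℓ K ≤ A) {c : ℝ} {x : X}
    (hx : |T.height x - c| ≤ 2 * A) : T.Window A c x := by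
  have h := T.pos_of_minScale_le hA
  unfold Window
  linarith

theorem two_le_length_side (hA : minScale ℓ K ≤ A) {s : List (Bool × Bool)} {x : X}
    (hx : |T.height x - T.center A s| ≤ 2 * A) (b : Bool) :
    2 ≤ (T.side (T.center A s) b (T.nodeCutset A s x)).length := by
  have h := T.pos_of_minScale_le hA
  cases b with
  | true =>
    obtain ⟨z, hz, z', hz', hne, h₁, h₂⟩ := exists_two_mem_cutset_above hA hx
    refine List.two_le_length_of_mem (mem_side.2 ⟨hz, ?_⟩) (mem_side.2 ⟨hz', ?_⟩) hne <;>
      rw [decide_eq_true_eq] <;> linarith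
  | false =>
    obtain ⟨z, hz, z', hz', hne, h₁, h₂⟩ := exists_two_mem_cutset_below hA hx
    refine List.two_le_length_of_mem (mem_side.2 ⟨hz, ?_⟩) (mem_side.2 ⟨hz', ?_⟩) hne <;>
      rw [decide_eq_false_iff_not, not_le] <;> linarith

theorem bunch_cons {s : List (Bool × Bool)} {x : X} {old : List X}
    (h : T.bunch A s = x :: old) (b i : Bool) :
    T.bunch A ((b, i) :: s) = splitLists (T.side (T.center A s) b old)
      (T.side (T.center A s) b (T.nodeCutset A s x)) i := by
  rw [bunch, h]

theorem abs_height_sub_center_cons {s : List (Bool × Bool)} {y : X} {b : Bool} (i : Bool)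
    (h : |T.height y - T.center A s| ≤ 3 * A)
    (hb : decide (T.center A s ≤ T.height y) = b) :
    |T.height y - T.center A ((b, i) :: s)| ≤ 2 * A := by
  rw [abs_le] at *
  cases b with
  | true =>
    rw [decide_eq_true_eq] at hb
    simp only [center, level, cond_true] at *
    constructor <;> linarith
  | false =>
    rw [decide_eq_false_iff_not, not_le] at hb
    simp only [center, level, cond_false] at *
    constructor <;> linarith

theorem isBunch_bunch (hA : minScale ℓ K ≤ A) (s : List (Bool × Bool)) :
    T.IsBunch A s (T.bunch A s) := by
  have hpos := T.pos_of_minScale_le hA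
  induction s with
  | nil =>
    refine ⟨by simp [bunch], ?_, by simp [bunch], ⟨T.root, by simp [bunch]⟩, ?_⟩
    · simp only [bunch, List.mem_singleton, forall_eq, center, level, mul_zero, add_zero, sub_self,
        abs_zero]
      linarith
    · simp [bunch, Nat.one_le_pow]
  | cons a s ih =>
    obtain ⟨b, i⟩ := a
    obtain ⟨x, old, hs⟩ := List.exists_cons_of_ne_nil ih.ne_nil
    rw [hs] at ih
    rw [bunch_cons hs]
    have hx := ih.abs_height_sub_le x (by simp)
    refine ⟨splitLists_ne_nil (two_le_length_side hA hx b) i, ?_, ?_, ?_, ?_⟩ <;>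
      rcases splitLists_sublist (T.side (T.center A s) b old)
        (T.side (T.center A s) b (T.nodeCutset A s x)) i with hsub | hsub
    · intro y hy
      obtain ⟨hy, hyb⟩ := mem_side.1 (hsub.subset hy)
      exact abs_height_sub_center_cons i
        ((ih.abs_height_sub_le y (List.mem_cons_of_mem _ hy)).trans (by linarith)) hyb
    · intro y hy
      obtain ⟨hy, hyb⟩ := mem_side.1 (hsub.subset hy)
      refine abs_height_sub_center_cons i ?_ hyb
      have := abs_height_sub_le_of_mem_cutset (R := 3 * A - K) (fun _ => Iff.rfl)
        (by linarith) hy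
      linarith
    · exact (ih.pairwise.sublist (List.sublist_cons_self _ _)).sublist
        (hsub.trans (side_sublist _ _ _))
    · exact (pairwise_cutset _ _).sublist (hsub.trans (side_sublist _ _ _))
    · obtain ⟨w, hw⟩ := ih.near
      exact ⟨w, fun y hy =>
        hw y (List.mem_cons_of_mem _ ((hsub.trans (side_sublist _ _ _)).subset hy))⟩
    · exact ⟨x, fun y hy =>
        (anc_of_mem_cutset ((hsub.trans (side_sublist _ _ _)).subset hy)).2⟩
    · have h₁ := (hsub.trans (side_sublist _ _ _)).length_le
      have h₂ := ih.length_le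
      rw [List.length_cons] at h₂
      omega
    · exact (hsub.trans (side_sublist _ _ _)).length_le.trans (length_cutset_le _ _)

/-- The vertex of the tree that corresponds to the node `s` of the standard tree. -/
noncomputable def vertexAt (T : ClimbingTree X L ℓ K) (A : ℝ) (s : List (Bool × Bool)) : X :=
  (T.bunch A s).headD T.root

theorem exists_bunch_eq (hA : minScale ℓ K ≤ A) (s : List (Bool × Bool)) :
    ∃ old, T.bunch A s = T.vertexAt A s :: old := by
  obtain ⟨x, old, hs⟩ := List.exists_cons_of_ne_nil (isBunch_bunch (T := T) hA s).ne_nil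
  exact ⟨old, by simp [vertexAt, hs]⟩

theorem vertexAt_mem_bunch (hA : minScale ℓ K ≤ A) (s : List (Bool × Bool)) :
    T.vertexAt A s ∈ T.bunch A s := by
  obtain ⟨old, hs⟩ := exists_bunch_eq (T := T) hA s
  simp [hs]

theorem window_vertexAt (hA : minScale ℓ K ≤ A) (s : List (Bool × Bool)) :
    T.Window A (T.center A s) (T.vertexAt A s) :=
  window_of_abs_le hA ((isBunch_bunch hA s).abs_height_sub_le _ (vertexAt_mem_bunch hA s))

/-- `v` is a descendant of a member of the bunch at `s`. -/
def BelowBunch (T : ClimbingTree X L ℓ K) (A : ℝ) (s : List (Bool × Bool)) (v : X) : Prop :=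
  ∃ t ∈ T.bunch A s, T.Anc t v

/-- `v` is one of the vertices that are passed when the first member of the bunch at `s` is replaced
by a cutset. -/
def PassedAt (T : ClimbingTree X L ℓ K) (A : ℝ) (s : List (Bool × Bool)) (v : X) : Prop :=
  T.Anc (T.vertexAt A s) v ∧ ∀ t ∈ T.nodeCutset A s (T.vertexAt A s), ¬ T.Anc t v

theorem mem_bunch_cons (hA : minScale ℓ K ≤ A) {s : List (Bool × Bool)} {b i : Bool} {y : X}
    (hy : y ∈ T.bunch A ((b, i) :: s)) :
    y ∈ T.bunch A s ∧ T.DisjointBelow (T.vertexAt A s) y ∨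
      y ∈ T.nodeCutset A s (T.vertexAt A s) := by
  obtain ⟨old, hs⟩ := exists_bunch_eq (T := T) hA s
  have hp := (isBunch_bunch (T := T) hA s).pairwise
  rw [hs, List.pairwise_cons] at hp
  rw [bunch_cons hs] at hy
  rcases splitLists_sublist (T.side (T.center A s) b old)
    (T.side (T.center A s) b (T.nodeCutset A s (T.vertexAt A s))) i with hsub | hsub
  · have hy' := (mem_side.1 (hsub.subset hy)).1
    exact Or.inl ⟨by rw [hs]; exact List.mem_cons_of_mem _ hy', hp.1 y hy'⟩
  · exact Or.inr (mem_side.1 (hsub.subset hy)).1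

theorem BelowBunch.of_cons (hA : minScale ℓ K ≤ A) {a : Bool × Bool} {s : List (Bool × Bool)}
    {v : X} (h : T.BelowBunch A (a :: s) v) : T.BelowBunch A s v ∧ ¬ T.PassedAt A s v := by
  obtain ⟨t, ht, htv⟩ := h
  rcases mem_bunch_cons hA ht with ⟨ht', hd⟩ | ht'
  · exact ⟨⟨t, ht', htv⟩, fun h => hd v h.1 htv⟩
  · exact ⟨⟨T.vertexAt A s, vertexAt_mem_bunch hA s, (anc_of_mem_cutset ht').1.trans htv⟩,
      fun h => h.2 t ht' htv⟩

theorem BelowBunch.of_append (hA : minScale ℓ K ≤ A) {l s : List (Bool × Bool)} {v : X}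
    (h : T.BelowBunch A (l ++ s) v) : T.BelowBunch A s v := by
  induction l with
  | nil => exact h
  | cons a l ih => exact ih (h.of_cons hA).1

theorem PassedAt.belowBunch (hA : minScale ℓ K ≤ A) {s : List (Bool × Bool)} {v : X}
    (h : T.PassedAt A s v) : T.BelowBunch A s v :=
  ⟨_, vertexAt_mem_bunch hA s, h.1⟩

/-- The parts that belong to different children of a node are disjoint. -/
theorem eq_of_belowBunch_cons (hA : minScale ℓ K ≤ A) {a a' : Bool × Bool}
    {s : List (Bool × Bool)} {v : X} (h : T.BelowBunch A (a :: s) v)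
    (h' : T.BelowBunch A (a' :: s) v) : a = a' := by
  obtain ⟨b, i⟩ := a
  obtain ⟨b', i'⟩ := a'
  obtain ⟨t, ht, htv⟩ := h
  obtain ⟨t', ht', htv'⟩ := h'
  obtain ⟨old, hs⟩ := exists_bunch_eq (T := T) hA s
  have hp := (isBunch_bunch (T := T) hA s).pairwise
  rw [hs, List.pairwise_cons] at hp
  have hpw : (old ++ T.nodeCutset A s (T.vertexAt A s)).Pairwise T.DisjointBelow := by
    refine List.pairwise_append.2 ⟨hp.2, pairwise_cutset _ _, fun y hy z hz => ?_⟩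
    exact ((Std.Symm.symm _ _ (hp.1 y hy))).mono (SimpleGraph.isAncestor_refl _ _ _)
      (anc_of_mem_cutset hz).1
  rw [bunch_cons hs] at ht ht'
  have hmem : ∀ {b i y}, y ∈ splitLists (T.side (T.center A s) b old)
      (T.side (T.center A s) b (T.nodeCutset A s (T.vertexAt A s))) i →
      y ∈ old ++ T.nodeCutset A s (T.vertexAt A s) ∧
        decide (T.center A s ≤ T.height y) = b := by
    intro b i y hy
    rw [List.mem_append]
    rcases splitLists_sublist (T.side (T.center A s) b old)
      (T.side (T.center A s) b (T.nodeCutset A s (T.vertexAt A s))) i with hsub | hsub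
    · exact ⟨Or.inl (mem_side.1 (hsub.subset hy)).1, (mem_side.1 (hsub.subset hy)).2⟩
    · exact ⟨Or.inr (mem_side.1 (hsub.subset hy)).1, (mem_side.1 (hsub.subset hy)).2⟩
  obtain rfl : t = t' := by
    by_contra hne
    exact hpw.forall (hmem ht).1 (hmem ht').1 hne v htv htv'
  obtain rfl : b = b' := (hmem ht).2.symm.trans (hmem ht').2
  have hpw' : (T.side (T.center A s) b old ++
      T.side (T.center A s) b (T.nodeCutset A s (T.vertexAt A s))).Pairwise T.DisjointBelow :=
    hpw.sublist ((side_sublist _ _ _).append (side_sublist _ _ _))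
  cases i <;> cases i'
  · rfl
  · exact absurd rfl (rel_of_mem_splitLists hpw' ht' ht).ne
  · exact absurd rfl (rel_of_mem_splitLists hpw' ht ht').ne
  · rfl

theorem suffix_of_belowBunch (hA : minScale ℓ K ≤ A) {s s' : List (Bool × Bool)} {v : X}
    (h : T.BelowBunch A s v) (h' : T.PassedAt A s' v) : s <:+ s' := by
  induction s with
  | nil => exact List.nil_suffix
  | cons a s ih =>
    obtain ⟨hs, hn⟩ := h.of_cons hA
    obtain ⟨l, rfl⟩ := ih hs
    rcases List.eq_nil_or_concat l with rfl | ⟨l, a', rfl⟩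
    · exact absurd h' hn
    · rw [List.concat_eq_append, List.append_assoc, List.singleton_append] at *
      obtain rfl := eq_of_belowBunch_cons hA h ((h'.belowBunch hA).of_append hA)
      exact List.suffix_append _ _

theorem PassedAt.unique (hA : minScale ℓ K ≤ A) {s s' : List (Bool × Bool)} {v : X}
    (h : T.PassedAt A s v) (h' : T.PassedAt A s' v) : s = s' :=
  (suffix_of_belowBunch hA (h.belowBunch hA) h').eq_of_length_le
    (suffix_of_belowBunch hA (h'.belowBunch hA) h).length_le

theorem passedAt_vertexAt (hA : minScale ℓ K ≤ A) (s : List (Bool × Bool)) :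
    T.PassedAt A s (T.vertexAt A s) :=
  ⟨SimpleGraph.isAncestor_refl _ _ _,
    fun _ ht => not_anc_of_mem_cutset (window_vertexAt hA s) ht⟩

/-- A member of a bunch gets its turn after a bounded number of steps: as long as it does not, it
stays in a bunch that loses its first member in each step. -/
theorem exists_vertexAt_eq (hA : minScale ℓ K ≤ A) (n : ℕ) {s : List (Bool × Bool)} {y : X}
    (hy : y ∈ T.bunch A s) (hn : (T.bunch A s).length ≤ n) :
    ∃ l, l.length ≤ n ∧ T.vertexAt A (l ++ s) = y := by
  induction n generalizing s with
  | zero =>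
    rw [List.length_eq_zero_iff.1 (Nat.le_zero.1 hn)] at hy
    simp at hy
  | succ n ih =>
    obtain ⟨old, hs⟩ := exists_bunch_eq (T := T) hA s
    rw [hs, List.mem_cons] at hy
    rcases hy with rfl | hy
    · exact ⟨[], by simp, rfl⟩
    · obtain ⟨b, hb⟩ : ∃ b, y ∈ T.side (T.center A s) b old := ⟨_, mem_side.2 ⟨hy, rfl⟩⟩
      have hcons := bunch_cons hs b true
      rw [splitLists_true_of_mem hb] at hcons
      have hlen := (side_sublist (T := T) (T.center A s) b old).length_le
      rw [hs, List.length_cons] at hn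
      obtain ⟨l, hl, hly⟩ := ih (s := (b, true) :: s) (by rwa [hcons]) (by rw [hcons]; omega)
      exact ⟨l ++ [(b, true)], by simpa using hl, by simpa using hly⟩

/-- A bound for the length of the words by which neighbouring vertices differ. -/
noncomputable def stepBound (L ℓ : ℕ) (K A : ℝ) : ℕ := (L + 1) ^ cutDepth ℓ K A + 1

theorem PassedAt.exists_of_child (hA : minScale ℓ K ≤ A) {s : List (Bool × Bool)} {u v : X}
    (hu : T.PassedAt A s u) (huv : v ∈ T.children u) :
    ∃ l, l.length ≤ stepBound L ℓ K A ∧ T.PassedAt A (l ++ s) v := by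
  by_cases h : ∀ t ∈ T.nodeCutset A s (T.vertexAt A s), ¬ T.Anc t v
  · exact ⟨[], by simp, hu.1.trans (anc_of_mem_children huv), h⟩
  push Not at h
  obtain ⟨t, ht, htv⟩ := h
  obtain rfl : t = v := by
    by_contra hne
    obtain ⟨hadj, hd⟩ := T.mem_children.1 huv
    exact hu.2 t ht (T.isTree.isAncestor_parent htv hne hadj hd)
  obtain ⟨old, hs⟩ := exists_bunch_eq (T := T) hA s
  obtain ⟨b, hb⟩ : ∃ b, t ∈ T.side (T.center A s) b (T.nodeCutset A s (T.vertexAt A s)) :=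
    ⟨_, mem_side.2 ⟨ht, rfl⟩⟩
  obtain ⟨i, hi⟩ := exists_mem_splitLists (old := T.side (T.center A s) b old) hb
  rw [← bunch_cons hs] at hi
  obtain ⟨l, hl, hly⟩ := exists_vertexAt_eq hA _ hi (isBunch_bunch (T := T) hA _).length_le
  refine ⟨l ++ [(b, i)], by simpa [stepBound] using hl, ?_⟩
  rw [List.append_assoc, List.singleton_append]
  have := passedAt_vertexAt (T := T) hA (l ++ (b, i) :: s)
  rwa [hly] at this

theorem exists_passedAt (hA : minScale ℓ K ≤ A) (v : X) : ∃ s, T.PassedAt A s v := by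
  induction hn : T.graph.dist T.root v generalizing v with
  | zero =>
    obtain rfl := connected.dist_eq_zero_iff.1 hn
    refine ⟨[], ?_⟩
    simpa [vertexAt, bunch] using passedAt_vertexAt (T := T) hA []
  | succ n ih =>
    have hne : T.root ≠ v := by
      rintro rfl
      simp at hn
    obtain ⟨u, huv, hd, -⟩ := (SimpleGraph.isAncestor_root T.graph T.root v).exists_parent
      connected hne
    obtain ⟨s, hs⟩ := ih u (by omega)
    obtain ⟨l, -, h⟩ := hs.exists_of_child hA (T.mem_children.2 ⟨huv, hd⟩)
    exact ⟨_, h⟩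

theorem PassedAt.dist_le {s : List (Bool × Bool)} {v : X}
    (h : T.PassedAt A s v) : T.graph.dist (T.vertexAt A s) v ≤ cutDepth ℓ K A := by
  rcases dist_le_or_below_cutset (P := T.Window A (T.center A s)) (k := cutDepth ℓ K A) h.1 with
    h' | ⟨t, ht, htv⟩
  · exact h'
  · exact absurd htv (h.2 t ht)

theorem dist_vertexAt_cons (hA : minScale ℓ K ≤ A) (a : Bool × Bool) (s : List (Bool × Bool)) :
    T.graph.dist (T.vertexAt A s) (T.vertexAt A (a :: s)) ≤ 2 * cutDepth ℓ K A := by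
  rcases mem_bunch_cons hA (vertexAt_mem_bunch hA (a :: s)) with ⟨h, -⟩ | h
  · obtain ⟨x, hx⟩ := (isBunch_bunch (T := T) hA s).near
    have h₁ := hx _ (vertexAt_mem_bunch hA s)
    have h₂ := hx _ h
    have h₃ := T.connected.dist_triangle (u := T.vertexAt A s) (v := x)
      (w := T.vertexAt A (a :: s))
    rw [SimpleGraph.dist_comm] at h₁
    omega
  · have := (anc_of_mem_cutset h).2
    omega

theorem dist_vertexAt_append (hA : minScale ℓ K ≤ A) (l s : List (Bool × Bool)) :
    T.graph.dist (T.vertexAt A s) (T.vertexAt A (l ++ s)) ≤ l.length * (2 * cutDepth ℓ K A) := by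
  induction l with
  | nil => simp
  | cons a l ih =>
    have h₁ := dist_vertexAt_cons (T := T) hA a (l ++ s)
    have h₂ := T.connected.dist_triangle (u := T.vertexAt A s) (v := T.vertexAt A (l ++ s))
      (w := T.vertexAt A (a :: (l ++ s)))
    rw [List.length_cons, Nat.succ_mul, List.cons_append]
    omega

open Classical in
/-- The node of the standard tree at which the vertex `v` is passed. -/
noncomputable def nodeOf (T : ClimbingTree X L ℓ K) (A : ℝ) (v : X) : List (Bool × Bool) :=
  if h : ∃ s, T.PassedAt A s v then h.choose else []

theorem passedAt_nodeOf (hA : minScale ℓ K ≤ A) (v : X) : T.PassedAt A (T.nodeOf A v) v := by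
  have h := exists_passedAt (T := T) hA v
  rw [nodeOf, dif_pos h]
  exact h.choose_spec

theorem nodeOf_vertexAt (hA : minScale ℓ K ≤ A) (s : List (Bool × Bool)) :
    T.nodeOf A (T.vertexAt A s) = s :=
  (passedAt_nodeOf hA _).unique hA (passedAt_vertexAt hA s)

theorem abs_height_sub_center_nodeOf (hA : minScale ℓ K ≤ A) (v : X) :
    |T.height v - T.center A (T.nodeOf A v)| ≤ 2 * A + K * cutDepth ℓ K A := by
  have h₁ := abs_height_sub_le_mul ((passedAt_nodeOf (T := T) hA v).dist_le)
  have h₂ := (isBunch_bunch (T := T) hA (T.nodeOf A v)).abs_height_sub_le _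
    (vertexAt_mem_bunch hA _)
  have h₃ := abs_sub_le (T.height v) (T.height (T.vertexAt A (T.nodeOf A v)))
    (T.center A (T.nodeOf A v))
  linarith

theorem nodeOf_eq_append (hA : minScale ℓ K ≤ A) {u v : X} (h : T.graph.Adj u v) :
    ∃ l, l.length ≤ stepBound L ℓ K A ∧
      (T.nodeOf A v = l ++ T.nodeOf A u ∨ T.nodeOf A u = l ++ T.nodeOf A v) := by
  have key : ∀ u v, v ∈ T.children u → ∃ l : List (Bool × Bool),
      l.length ≤ stepBound L ℓ K A ∧ T.nodeOf A v = l ++ T.nodeOf A u := by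
    intro u v huv
    obtain ⟨l, hl, h⟩ := (passedAt_nodeOf (T := T) hA u).exists_of_child hA huv
    exact ⟨l, hl, (passedAt_nodeOf hA v).unique hA h⟩
  rcases T.isTree.dist_eq_dist_add_one_of_adj T.root h with hd | hd
  · obtain ⟨l, hl, h⟩ := key v u (T.mem_children.2 ⟨h.symm, hd⟩)
    exact ⟨l, hl, Or.inr h⟩
  · obtain ⟨l, hl, h⟩ := key u v (T.mem_children.2 ⟨h, hd⟩)
    exact ⟨l, hl, Or.inl h⟩

/-! ### Comparing two climbing trees -/

variable {Y : Type*} {L' ℓ' : ℕ} {K' : ℝ} {T' : ClimbingTree Y L' ℓ' K'}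

/-- The map from one climbing tree to another one through the standard tree. -/
noncomputable def transfer (T : ClimbingTree X L ℓ K) (T' : ClimbingTree Y L' ℓ' K') (A : ℝ)
    (v : X) : Y :=
  T'.vertexAt A (T.nodeOf A v)

/-- A Lipschitz constant of `transfer`. -/
noncomputable def transferBound (L ℓ : ℕ) (K : ℝ) (ℓ' : ℕ) (K' A : ℝ) : ℕ :=
  stepBound L ℓ K A * (2 * cutDepth ℓ' K' A)

theorem dist_transfer_le (hA : minScale ℓ K ≤ A) (hA' : minScale ℓ' K' ≤ A) (x y : X) :
    T'.graph.dist (T.transfer T' A x) (T.transfer T' A y) ≤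
      transferBound L ℓ K ℓ' K' A * T.graph.dist x y := by
  refine connected.dist_map_le_mul_dist connected (fun u v huv => ?_) x y
  obtain ⟨l, hl, h⟩ := nodeOf_eq_append hA huv
  have hmul := Nat.mul_le_mul_right (2 * cutDepth ℓ' K' A) hl
  rcases h with h | h
  · rw [transfer, transfer, h]
    exact (dist_vertexAt_append hA' _ _).trans hmul
  · rw [transfer, transfer, h, SimpleGraph.dist_comm]
    exact (dist_vertexAt_append hA' _ _).trans hmul

/-- Going to the other tree and back moves vertices by a bounded distance. -/
theorem dist_transfer_transfer_le (hA : minScale ℓ K ≤ A) (hA' : minScale ℓ' K' ≤ A) (x : X) :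
    T.graph.dist (T'.transfer T A (T.transfer T' A x)) x ≤ cutDepth ℓ K A := by
  rw [transfer, transfer, nodeOf_vertexAt hA']
  exact (passedAt_nodeOf hA x).dist_le

theorem dist_le_dist_transfer (hA : minScale ℓ K ≤ A) (hA' : minScale ℓ' K' ≤ A) (x y : X) :
    T.graph.dist x y ≤ transferBound L' ℓ' K' ℓ K A *
      T'.graph.dist (T.transfer T' A x) (T.transfer T' A y) + 2 * cutDepth ℓ K A := by
  have h₁ := dist_transfer_le (T := T') (T' := T) hA' hA (T.transfer T' A x) (T.transfer T' A y)
  have h₂ := dist_transfer_transfer_le (T := T) (T' := T') hA hA' x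
  have h₃ := dist_transfer_transfer_le (T := T) (T' := T') hA hA' y
  have h₄ := T.connected.dist_triangle (u := x) (v := T'.transfer T A (T.transfer T' A x)) (w := y)
  have h₅ := T.connected.dist_triangle (u := T'.transfer T A (T.transfer T' A x))
    (v := T'.transfer T A (T.transfer T' A y)) (w := y)
  rw [SimpleGraph.dist_comm] at h₂
  omega

theorem abs_height_transfer_sub_le (hA : minScale ℓ K ≤ A) (hA' : minScale ℓ' K' ≤ A) (x y : X) :
    |(T'.height (T.transfer T' A y) - T'.height (T.transfer T' A x)) -
      (T.height y - T.height x)| ≤ 8 * A + 2 * (K * cutDepth ℓ K A) := by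
  have h₁ := abs_le.1 (abs_height_sub_center_nodeOf (T := T) hA x)
  have h₂ := abs_le.1 (abs_height_sub_center_nodeOf (T := T) hA y)
  have h₃ := abs_le.1 ((isBunch_bunch (T := T') hA' (T.nodeOf A x)).abs_height_sub_le _
    (vertexAt_mem_bunch hA' _))
  have h₄ := abs_le.1 ((isBunch_bunch (T := T') hA' (T.nodeOf A y)).abs_height_sub_le _
    (vertexAt_mem_bunch hA' _))
  unfold center at *
  unfold transfer
  rw [abs_le]
  constructor <;> linarith [h₁.1, h₁.2, h₂.1, h₂.2, h₃.1, h₃.2, h₄.1, h₄.2]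

end ClimbingTree

/-! ### Heights in directed graphs -/

namespace DirGraph

variable {G : DirGraph.{u₁, u₂}} {h : G.Edge → ℝ}

theorem HeightChange.trans {x y z : G.Vert} {s t : ℝ} (hxy : G.HeightChange h x y s)
    (hyz : G.HeightChange h y z t) : G.HeightChange h x z (s + t) := by
  induction hxy with
  | nil x => rwa [zero_add]
  | forward e _ ih => rw [add_assoc]; exact .forward e (ih hyz)
  | backward e _ ih => rw [add_assoc]; exact .backward e (ih hyz)

theorem HeightChange.reverse {x y : G.Vert} {t : ℝ} (hxy : G.HeightChange h x y t) :
    G.HeightChange h y x (-t) := by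
  induction hxy with
  | nil x => rw [neg_zero]; exact .nil x
  | forward e _ ih =>
    rw [neg_add_rev]
    simpa using ih.trans (.backward e (.nil (G.src e)))
  | backward e _ ih =>
    rw [neg_add_rev, neg_neg]
    simpa using ih.trans (.forward e (.nil (G.tgt e)))

theorem HeightChange.iterate {x : G.Vert} {t : ℝ} (hx : G.HeightChange h x x t) (n : ℕ) :
    G.HeightChange h x x (n * t) := by
  induction n with
  | zero => simpa using HeightChange.nil x
  | succ n ih =>
    have := ih.trans hx
    rwa [Nat.cast_succ, add_mul, one_mul]

theorem exists_heightChange_of_connected (hG : G.toSimple.Connected) (h : G.Edge → ℝ)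
    (x y : G.Vert) : ∃ t, G.HeightChange h x y t := by
  obtain ⟨p⟩ := hG.preconnected x y
  induction p with
  | nil => exact ⟨0, .nil _⟩
  | cons hadj p ih =>
    obtain ⟨t, ht⟩ := ih
    obtain ⟨-, e, ⟨rfl, rfl⟩ | ⟨rfl, rfl⟩⟩ := hadj
    · exact ⟨_, .forward e ht⟩
    · exact ⟨_, .backward e ht⟩

theorem HeightChange.eq_sub {H : G.Vert → ℝ} (hH : ∀ e, H (G.tgt e) = H (G.src e) + h e)
    {x y : G.Vert} {t : ℝ} (hxy : G.HeightChange h x y t) : t = H y - H x := by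
  induction hxy with
  | nil x => simp
  | forward e _ ih => rw [ih, hH]; ring
  | backward e _ ih => rw [ih, hH]; ring

/-- From each vertex of a base, edge paths lead arbitrarily far up. -/
theorem IsBase.exists_heightChange_ge (hG : G.IsBase h) (x : G.Vert) :
    ∃ y t, 1 ≤ t ∧ G.HeightChange h x y t := by
  obtain ⟨v, t, ht, hv⟩ := hG.exists_loop
  obtain ⟨s, hs⟩ := exists_heightChange_of_connected hG.connected h x v
  obtain ⟨n, hn⟩ := Archimedean.arch (1 - s) ht
  rw [nsmul_eq_mul] at hn
  exact ⟨v, s + n * t, by linarith, hs.trans (hv.iterate n)⟩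

/-- From each vertex of a base, edge paths lead arbitrarily far down. -/
theorem IsBase.exists_heightChange_le (hG : G.IsBase h) (x : G.Vert) :
    ∃ y t, t ≤ -1 ∧ G.HeightChange h x y t := by
  obtain ⟨v, t, ht, hv⟩ := hG.exists_loop
  obtain ⟨s, hs⟩ := exists_heightChange_of_connected hG.connected h x v
  obtain ⟨n, hn⟩ := Archimedean.arch (1 + s) ht
  rw [nsmul_eq_mul] at hn
  exact ⟨v, s + n * -t, by linarith, hs.trans (hv.reverse.iterate n)⟩

/-- The endpoint of `e` at which one starts when crossing `e` along its direction (if `b` is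
true) or backwards (if `b` is false). -/
def start (G : DirGraph.{u₁, u₂}) (b : Bool) (e : G.Edge) : G.Vert :=
  bif b then G.src e else G.tgt e

/-- The height change across an edge that is crossed along its direction (if `b` is true) or
backwards (if `b` is false). -/
def signed (b : Bool) (t : ℝ) : ℝ := bif b then t else -t

theorem signed_not (b : Bool) (t : ℝ) : signed (!b) t = -signed b t := by
  cases b <;> simp [signed]

theorem IsTree.adj_start (hG : G.IsTree) (b : Bool) (e : G.Edge) :
    G.toSimple.Adj (G.start b e) (G.start (!b) e) := by
  have := hG.no_loop e
  cases b
  · exact ⟨this.symm, e, Or.inr ⟨rfl, rfl⟩⟩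
  · exact ⟨this, e, Or.inl ⟨rfl, rfl⟩⟩

theorem IsTree.edge_unique (hG : G.IsTree) {b b' : Bool} {e e' : G.Edge}
    (h₁ : G.start b e = G.start b' e') (h₂ : G.start (!b) e = G.start (!b') e') : e = e' := by
  apply hG.no_multi
  cases b <;> cases b' <;> simp_all [start]

/-- A tree with a height change on each edge has a height function. -/
theorem IsTree.exists_height (hG : G.IsTree) (g : G.Edge → ℝ) :
    ∃ H : G.Vert → ℝ, ∀ e, H (G.tgt e) = H (G.src e) + g e := by
  classical
  have hc := hG.tree.connected
  obtain ⟨o⟩ := hc.nonempty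
  -- the height of `x` is a sum over the edges on the path from the root to `x`
  have hpar : ∀ x, ∃ y, x ≠ o → ∃ b e, G.start b e = y ∧ G.start (!b) e = x ∧
      G.toSimple.dist o x = G.toSimple.dist o y + 1 := by
    intro x
    by_cases hx : x = o
    · exact ⟨x, fun h => absurd hx h⟩
    obtain ⟨y, hy, hd, -⟩ :=
      (SimpleGraph.isAncestor_root G.toSimple o x).exists_parent hc (Ne.symm hx)
    obtain ⟨-, e, ⟨h₁, h₂⟩ | ⟨h₁, h₂⟩⟩ := hy
    · exact ⟨y, fun _ => ⟨true, e, h₁, h₂, hd⟩⟩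
    · exact ⟨y, fun _ => ⟨false, e, h₂, h₁, hd⟩⟩
  choose par hpar using hpar
  have hchoose : ∀ x, ∃ t : ℝ, x ≠ o → ∃ b e, G.start b e = par x ∧ G.start (!b) e = x ∧
      t = signed b (g e) := by
    intro x
    by_cases hx : x = o
    · exact ⟨0, fun h => absurd hx h⟩
    obtain ⟨b, e, h₁, h₂, -⟩ := hpar x hx
    exact ⟨signed b (g e), fun _ => ⟨b, e, h₁, h₂, rfl⟩⟩
  choose wt hwt using hchoose
  let H : G.Vert → ℝ := fun x => ∑ i ∈ Finset.range (G.toSimple.dist o x), wt (par^[i] x)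
  have key : ∀ b e, G.toSimple.dist o (G.start (!b) e) = G.toSimple.dist o (G.start b e) + 1 →
      H (G.start (!b) e) = H (G.start b e) + signed b (g e) := by
    intro b e hd
    have hne : G.start (!b) e ≠ o := by
      intro h0
      rw [h0, SimpleGraph.dist_self] at hd
      omega
    obtain ⟨b', e', h₁, h₂, hd'⟩ := hpar _ hne
    have hp : par (G.start (!b) e) = G.start b e := by
      refine hG.tree.parent_unique (o := o) ?_ (hG.adj_start b e) hd' hd
      have := hG.adj_start b' e'
      rwa [h₁, h₂] at this
    obtain ⟨b'', e'', h₃, h₄, ht⟩ := hwt _ hne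
    rw [hp] at h₃
    obtain rfl := hG.edge_unique h₃ h₄
    obtain rfl : b'' = b := by
      have := hG.no_loop e''
      cases b <;> cases b'' <;> simp_all [start]
    simp only [H]
    rw [hd, Finset.sum_range_succ']
    simp only [Function.iterate_succ_apply, Function.iterate_zero, id, hp, ht]
  refine ⟨H, fun e => ?_⟩
  rcases hG.tree.dist_eq_dist_add_one_of_adj o (hG.adj_start true e) with hd | hd
  · have := key false e hd
    simp only [signed, start, Bool.not_false, cond_true, cond_false] at this
    linarith
  · exact key true e hd

/-! ### Lifting edge paths to descending paths -/

theorem one_le_requiredCount (e : G.Edge) : 1 ≤ G.requiredCount e := by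
  unfold requiredCount
  split_ifs
  · exact le_rfl
  · exact one_le_two

theorem requiredCount_of_ne {e : G.Edge} (he : G.src e ≠ G.tgt e) : G.requiredCount e = 2 := by
  simp [requiredCount, he]

variable {V : DirGraph.{u₃, u₄}} {p : V.Hom G} {L : ℕ}

theorem Hom.start_onEdge (p : V.Hom G) (b : Bool) (f : V.Edge) :
    G.start b (p.onEdge f) = p.onVert (V.start b f) := by
  cases b
  · exact p.tgt_onEdge f
  · exact p.src_onEdge f

theorem Hom.IsTreeCover.requiredCount_le (hp : p.IsTreeCover L) {b : Bool} {v : V.Vert}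
    {e : G.Edge} (he : G.start b e = p.onVert v) :
    G.requiredCount e ≤ {f | V.start b f = v ∧ p.onEdge f = e}.encard := by
  cases b
  · exact hp.incoming v e he
  · exact hp.outgoing v e he

/-- In a rooted tree, at most one of two edges at a vertex leads towards the root. -/
theorem IsTree.child_or_child (hV : V.IsTree) (o : V.Vert) {b b' : Bool} {f f' : V.Edge}
    (h : V.start b f = V.start b' f') (hne : f ≠ f') :
    V.toSimple.dist o (V.start (!b) f) = V.toSimple.dist o (V.start b f) + 1 ∨
      V.toSimple.dist o (V.start (!b') f') = V.toSimple.dist o (V.start b' f') + 1 := by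
  have hf := hV.adj_start b f
  have hf' := hV.adj_start b' f'
  rcases hV.tree.dist_eq_dist_add_one_of_adj o hf with hd | hd
  · rcases hV.tree.dist_eq_dist_add_one_of_adj o hf' with hd' | hd'
    · rw [h] at hf hd
      exact absurd (hV.edge_unique h (hV.tree.parent_unique hf.symm hf'.symm hd hd')) hne
    · exact Or.inr hd'
  · exact Or.inl hd

/-- `f` is an edge over `e` that leads from `v` to a child of `v` in the tree with root `o`,
crossed in the direction given by `b`. -/
structure IsChildEdge (p : V.Hom G) (o : V.Vert) (b : Bool) (e : G.Edge) (v : V.Vert)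
    (f : V.Edge) : Prop where
  start_eq : V.start b f = v
  onEdge_eq : p.onEdge f = e
  dist_eq : V.toSimple.dist o (V.start (!b) f) = V.toSimple.dist o v + 1

theorem exists_isChildEdge_of_two (hp : p.IsTreeCover L) (o : V.Vert) {b : Bool} {v : V.Vert}
    {e : G.Edge} (he : G.start b e = p.onVert v) (h2 : G.requiredCount e = 2) :
    ∃ f, IsChildEdge p o b e v f := by
  have h := hp.requiredCount_le he
  rw [h2] at h
  obtain ⟨f, f', ⟨hf, hfe⟩, ⟨hf', hfe'⟩, hne⟩ :=
    Set.one_lt_encard_iff.1 (lt_of_lt_of_le (by norm_num) h)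
  rcases hp.isTree.child_or_child o (hf.trans hf'.symm) hne with hd | hd
  · exact ⟨f, hf, hfe, by rw [hd, hf]⟩
  · exact ⟨f', hf', hfe', by rw [hd, hf']⟩

/-- Every edge lifts to an edge that leads to a child, if the edge towards the root lies over a
different edge. -/
theorem exists_isChildEdge_of_parent (hp : p.IsTreeCover L) {o : V.Vert} {b b' : Bool} {v : V.Vert}
    {e : G.Edge} (he : G.start b e = p.onVert v) {f' : V.Edge} (hf' : V.start b' f' = v)
    (hd : ¬ V.toSimple.dist o (V.start (!b') f') = V.toSimple.dist o v + 1)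
    (hne : p.onEdge f' ≠ e) : ∃ f, IsChildEdge p o b e v f := by
  have h := (one_le_requiredCount e).trans (hp.requiredCount_le he)
  obtain ⟨f, hf, hfe⟩ := Set.one_le_encard_iff_nonempty.1 h
  have hne' : f ≠ f' := by
    rintro rfl
    exact hne hfe
  rcases hp.isTree.child_or_child o (hf.trans hf'.symm) hne' with h' | h'
  · exact ⟨f, hf, hfe, by rw [h', hf]⟩
  · rw [hf'] at h'
    exact absurd h' hd

/-- `u` is a descendant of `v` at distance at most `n`, and its height is larger by `t`. -/
structure Reaches (V : DirGraph.{u₃, u₄}) (H : V.Vert → ℝ) (o : V.Vert) (n : ℕ) (v u : V.Vert)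
    (t : ℝ) : Prop where
  isAncestor : V.toSimple.IsAncestor o v u
  dist_le : V.toSimple.dist v u ≤ n
  height_eq : H u = H v + t

theorem Reaches.trans (hV : V.IsTree) {H : V.Vert → ℝ} {o u v w : V.Vert} {m n : ℕ} {s t : ℝ}
    (h : V.Reaches H o m u v s) (h' : V.Reaches H o n v w t) :
    V.Reaches H o (m + n) u w (s + t) where
  isAncestor := h.isAncestor.trans hV.tree.connected h'.isAncestor
  dist_le := (hV.tree.connected.dist_triangle (v := v)).trans (add_le_add h.dist_le h'.dist_le)
  height_eq := by rw [h'.height_eq, h.height_eq, add_assoc]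

theorem IsChildEdge.reaches (hV : V.IsTree) {H : V.Vert → ℝ}
    (hH : ∀ e, H (V.tgt e) = H (V.src e) + p.lift h e) {o v : V.Vert} {b : Bool} {e : G.Edge}
    {f : V.Edge} (hf : IsChildEdge p o b e v f) :
    V.Reaches H o 1 v (V.start (!b) f) (signed b (h e)) := by
  obtain ⟨rfl, rfl, hd⟩ := hf
  have hadj := hV.adj_start b f
  refine ⟨SimpleGraph.isAncestor_of_adj hadj hd, (SimpleGraph.dist_eq_one_iff_adj.2 hadj).le, ?_⟩
  have := hH f
  unfold Hom.lift at this
  cases b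
  · simp only [start, signed, Bool.not_false, cond_true, cond_false]
    linarith
  · simpa only [start, signed, Bool.not_true, cond_true, cond_false] using this

theorem IsChildEdge.onVert_eq {o v : V.Vert} {b : Bool} {e : G.Edge} {f : V.Edge}
    (hf : IsChildEdge p o b e v f) : p.onVert (V.start (!b) f) = G.start (!b) e := by
  rw [← p.start_onEdge, hf.onEdge_eq]

/-- After going to a child, every edge over a different edge of the base lifts to an edge to a
child again. -/
theorem IsChildEdge.exists_next (hp : p.IsTreeCover L) {o v : V.Vert} {b b' : Bool}
    {e e' : G.Edge} {f : V.Edge} (hf : IsChildEdge p o b e v f)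
    (he' : G.start b' e' = G.start (!b) e) (hne : e ≠ e') :
    ∃ f', IsChildEdge p o b' e' (V.start (!b) f) f' := by
  refine exists_isChildEdge_of_parent hp (he'.trans hf.onVert_eq.symm) (f' := f) (b' := !b) rfl
    ?_ (by rw [hf.onEdge_eq]; exact hne)
  rw [Bool.not_not, hf.start_eq, hf.dist_eq]
  omega

/-- Every edge of the base lifts to a descending path of length at most three. If the only lift of a
loop `e` leads towards the root, then a detour is made: the path crosses a lift of another edge,
then a lift of `e`, and then a lift of the other edge backwards; if the other edge is not a loop, it
is crossed backwards before `e`. -/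
theorem exists_reaches_of_edge (hG : G.toSimple.Connected) (hp : p.IsTreeCover L)
    {H : V.Vert → ℝ} (hH : ∀ e, H (V.tgt e) = H (V.src e) + p.lift h e) (o : V.Vert) {b : Bool}
    {v : V.Vert} {e : G.Edge} (he : G.start b e = p.onVert v) :
    ∃ u, V.Reaches H o 3 v u (signed b (h e)) ∧ p.onVert u = G.start (!b) e := by
  have hV := hp.isTree
  have of_child : ∀ {f}, IsChildEdge p o b e v f →
      ∃ u, V.Reaches H o 3 v u (signed b (h e)) ∧ p.onVert u = G.start (!b) e := fun {f} hf =>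
    ⟨_, ⟨(hf.reaches hV hH).isAncestor, (hf.reaches hV hH).dist_le.trans (by norm_num),
      (hf.reaches hV hH).height_eq⟩, hf.onVert_eq⟩
  by_cases hloop : G.src e = G.tgt e ∧ ¬ (Nat.card G.Vert = 1 ∧ Nat.card G.Edge = 1)
  swap
  · obtain ⟨f, hf⟩ := exists_isChildEdge_of_two hp o he
      (by simp only [requiredCount, if_neg hloop])
    exact of_child hf
  obtain ⟨hloop, hcard⟩ := hloop
  by_cases hn : ∃ n b', G.start b' n = p.onVert v ∧ G.src n ≠ G.tgt n
  · obtain ⟨n, b', hn, hne⟩ := hn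
    have h2 := requiredCount_of_ne hne
    have hen : n ≠ e := by
      rintro rfl
      exact hne hloop
    obtain ⟨f₁, hf₁⟩ := exists_isChildEdge_of_two hp o hn h2
    obtain ⟨f₂, hf₂⟩ := exists_isChildEdge_of_two hp o hf₁.onVert_eq.symm h2
    obtain ⟨f₃, hf₃⟩ := hf₂.exists_next hp (b' := b) (e' := e)
      (by rw [Bool.not_not, he, hn]) hen
    refine ⟨_, ?_, hf₃.onVert_eq⟩
    have := ((hf₁.reaches hV hH).trans hV (hf₂.reaches hV hH)).trans hV (hf₃.reaches hV hH)
    rwa [signed_not, add_neg_cancel, zero_add] at this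
  push Not at hn
  -- now `p.onVert v` is the only vertex of the base, and all edges are loops
  have hvert : ∀ x, x = p.onVert v := by
    intro x
    by_contra hx
    obtain ⟨w, ⟨hne, n, hadj⟩, -⟩ := hG.exists_adj_dist_eq
      (x := p.onVert v) (y := x) (n := G.toSimple.dist (p.onVert v) x - 1)
      (by have := hG.pos_dist_of_ne (Ne.symm hx); omega)
    rcases hadj with ⟨h₁, h₂⟩ | ⟨h₁, h₂⟩
    · exact hne (by rw [← h₁, hn n true h₁, h₂])
    · exact hne (by rw [← h₂, ← hn n false h₂, h₁])
  obtain ⟨g, hg⟩ : ∃ g, e ≠ g := by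
    by_contra hall
    push Not at hall
    refine hcard ⟨Nat.card_eq_one_iff_exists.2 ⟨_, hvert⟩,
      Nat.card_eq_one_iff_exists.2 ⟨e, fun g => (hall g).symm⟩⟩
  obtain ⟨f, hf, hfe⟩ := Set.one_le_encard_iff_nonempty.1
    ((one_le_requiredCount e).trans (hp.requiredCount_le he))
  by_cases hd : V.toSimple.dist o (V.start (!b) f) = V.toSimple.dist o v + 1
  · exact of_child ⟨hf, hfe, hd⟩
  obtain ⟨f₁, hf₁⟩ := exists_isChildEdge_of_parent hp (b := true) (e := g)
    (hvert _) hf hd (by rw [hfe]; exact hg)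
  obtain ⟨f₂, hf₂⟩ := hf₁.exists_next hp (b' := b) (e' := e) (by rw [hvert (G.start b e), ← hvert _])
    hg.symm
  obtain ⟨f₃, hf₃⟩ := hf₂.exists_next hp (b' := !true) (e' := g)
    (by rw [hvert (G.start _ g), ← hvert _]) hg
  refine ⟨V.start (!(!true)) f₃, ?_, (hvert _).trans (hvert _).symm⟩
  have := ((hf₁.reaches hV hH).trans hV (hf₂.reaches hV hH)).trans hV (hf₃.reaches hV hH)
  rwa [signed_not, add_comm (signed true (h g)), add_neg_cancel_right] at this

/-- Every edge path of the base lifts to a descending path, whose length is bounded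
independently of the tree. -/
theorem HeightChange.exists_reaches (hG : G.toSimple.Connected) {x y : G.Vert} {t : ℝ}
    (hxy : G.HeightChange h x y t) :
    ∃ n : ℕ, ∀ (V : DirGraph.{u₃, u₄}) (p : V.Hom G) (L : ℕ) (H : V.Vert → ℝ) (o v : V.Vert),
      p.IsTreeCover L → (∀ e, H (V.tgt e) = H (V.src e) + p.lift h e) → p.onVert v = x →
      ∃ u, V.Reaches H o n v u t ∧ p.onVert u = y := by
  induction hxy with
  | nil x =>
    exact ⟨0, fun V p L H o v _ _ hv =>
      ⟨v, ⟨SimpleGraph.isAncestor_refl _ _ _, by simp, by simp⟩, hv⟩⟩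
  | forward e _ ih =>
    obtain ⟨n, ih⟩ := ih
    refine ⟨3 + n, fun V p L H o v hp hH hv => ?_⟩
    obtain ⟨u, hu, hue⟩ := exists_reaches_of_edge hG hp hH o (b := true) hv.symm
    obtain ⟨w, hw, hwy⟩ := ih V p L H o u hp hH hue
    exact ⟨w, hu.trans hp.isTree hw, hwy⟩
  | backward e _ ih =>
    obtain ⟨n, ih⟩ := ih
    refine ⟨3 + n, fun V p L H o v hp hH hv => ?_⟩
    obtain ⟨u, hu, hue⟩ := exists_reaches_of_edge hG hp hH o (b := false) hv.symm
    obtain ⟨w, hw, hwy⟩ := ih V p L H o u hp hH hue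
    exact ⟨w, hu.trans hp.isTree hw, hwy⟩

/-- From each vertex of a tree over a base, one can descend a bounded number of steps to vertices
that are higher by at least one, and to vertices that are lower by at least one. -/
theorem IsBase.exists_climb (hG : G.IsBase h) :
    ∃ ℓ : ℕ, ∀ (V : DirGraph.{u₃, u₄}) (p : V.Hom G) (L : ℕ) (H : V.Vert → ℝ) (o v : V.Vert),
      p.IsTreeCover L → (∀ e, H (V.tgt e) = H (V.src e) + p.lift h e) →
      (∃ u, V.toSimple.IsAncestor o v u ∧ V.toSimple.dist v u ≤ ℓ ∧ H v + 1 ≤ H u) ∧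
        ∃ u, V.toSimple.IsAncestor o v u ∧ V.toSimple.dist v u ≤ ℓ ∧ H u ≤ H v - 1 := by
  have := hG.finite_vert
  choose y t ht hyt using hG.exists_heightChange_ge
  choose y' t' ht' hyt' using hG.exists_heightChange_le
  choose n hn using fun x => (hyt x).exists_reaches hG.connected
  choose n' hn' using fun x => (hyt' x).exists_reaches hG.connected
  obtain ⟨N, hN⟩ := (Set.finite_range n).bddAbove
  obtain ⟨N', hN'⟩ := (Set.finite_range n').bddAbove
  refine ⟨max N N', fun V p L H o v hp hH => ⟨?_, ?_⟩⟩
  · obtain ⟨u, hu, -⟩ := hn (p.onVert v) V p L H o v hp hH rfl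
    refine ⟨u, hu.isAncestor,
      (hu.dist_le.trans (hN ⟨p.onVert v, rfl⟩)).trans (le_max_left _ _), ?_⟩
    linarith [hu.height_eq, ht (p.onVert v)]
  · obtain ⟨u, hu, -⟩ := hn' (p.onVert v) V p L H o v hp hH rfl
    refine ⟨u, hu.isAncestor,
      (hu.dist_le.trans (hN' ⟨p.onVert v, rfl⟩)).trans (le_max_right _ _), ?_⟩
    linarith [hu.height_eq, ht' (p.onVert v)]

theorem ValenceLE.exists_children {V : DirGraph.{u₃, u₄}} (hV : V.ValenceLE L) (o v : V.Vert) :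
    ∃ l : List V.Vert, (∀ w, w ∈ l ↔ V.toSimple.Adj v w ∧
      V.toSimple.dist o w = V.toSimple.dist o v + 1) ∧ l.Nodup ∧ l.length ≤ L := by
  classical
  set E := {e | V.src e = v ∨ V.tgt e = v}
  set S := {w | V.toSimple.Adj v w ∧ V.toSimple.dist o w = V.toSimple.dist o v + 1}
  have hS : S ⊆ (fun e => if V.src e = v then V.tgt e else V.src e) '' E := by
    rintro w ⟨⟨hne, e, ⟨h₁, h₂⟩ | ⟨h₁, h₂⟩⟩, -⟩
    · exact ⟨e, Or.inl h₁, by simp [h₁, h₂]⟩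
    · exact ⟨e, Or.inr h₂, by simp [h₁, hne.symm]⟩
  have hcard : S.encard ≤ L := (Set.encard_le_encard hS).trans
    ((Set.encard_image_le _ _).trans (hV v))
  have hfin : S.Finite := Set.finite_of_encard_le_coe hcard
  refine ⟨hfin.toFinset.toList, fun w => by simp [S], Finset.nodup_toList _, ?_⟩
  rw [Finset.length_toList]
  rw [hfin.encard_eq_coe_toFinset_card] at hcard
  exact_mod_cast hcard

/-- Admissible trees over a base are climbing trees, with constants that depend on the base
only. -/
theorem IsBase.exists_climbingTree (hG : G.IsBase h) :
    ∃ (ℓ : ℕ) (K : ℝ), ∀ (L : ℕ) (V : DirGraph.{u₃, u₄}) (p : V.Hom G), p.IsTreeCover L →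
      ∃ T : ClimbingTree V.Vert L ℓ K, T.graph = V.toSimple ∧
        ∀ e, T.height (V.tgt e) = T.height (V.src e) + p.lift h e := by
  have := hG.finite_edge
  obtain ⟨ℓ, hℓ⟩ := hG.exists_climb
  obtain ⟨K, hK⟩ := (Set.finite_range fun e => |h e|).bddAbove
  refine ⟨ℓ, max K 0, fun L V p hp => ?_⟩
  obtain ⟨o⟩ := hp.isTree.tree.connected.nonempty
  obtain ⟨H, hH⟩ := hp.isTree.exists_height (p.lift h)
  choose ch hch hnodup hlen using hp.valence.exists_children o
  refine ⟨{ graph := V.toSimple, isTree := hp.isTree.tree, root := o, height := H, children := ch,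
            mem_children := fun {x y} => hch x y, nodup_children := hnodup,
            length_children := hlen, nonneg := le_max_right _ _, abs_height_sub := ?_,
            ascend := fun v => (hℓ V p L H o v hp hH).1,
            descend := fun v => (hℓ V p L H o v hp hH).2 }, rfl, hH⟩
  rintro x y ⟨-, e, ⟨rfl, rfl⟩ | ⟨rfl, rfl⟩⟩
  · rw [hH, add_sub_cancel_left]
    exact (hK ⟨p.onEdge e, rfl⟩).trans (le_max_left _ _)
  · rw [abs_sub_comm, hH, add_sub_cancel_left]
    exact (hK ⟨p.onEdge e, rfl⟩).trans (le_max_left _ _)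

end DirGraph

/-! ### Trees over two bases are quasi-isometric -/

open DirGraph ClimbingTree in
theorem lemmaL (Γ : DirGraph.{u₁, u₂}) (Γ' : DirGraph.{u₃, u₄})
    (h : Γ.Edge → ℝ) (h' : Γ'.Edge → ℝ) (hΓ : Γ.IsBase h) (hΓ' : Γ'.IsBase h') (L L' : ℕ) :
    ∃ lam ε C : ℝ, 1 ≤ lam ∧ 0 ≤ ε ∧ 0 ≤ C ∧
      ∀ (V : DirGraph.{u₅, u₆}) (W : DirGraph.{u₇, u₈}) (p : V.Hom Γ) (q : W.Hom Γ'),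
        p.IsTreeCover L → q.IsTreeCover L' →
        ∃ φ : V.Vert → W.Vert,
          V.IsQuasiIsometry W lam ε φ ∧
          V.IsCoarselyHeightPreserving W (p.lift h) (q.lift h') C φ := by
  obtain ⟨ℓ, K, hV⟩ := hΓ.exists_climbingTree
  obtain ⟨ℓ', K', hW⟩ := hΓ'.exists_climbingTree
  -- one scale for both trees, so that they are compared with the same standard tree
  set A : ℝ := max (minScale ℓ K) (minScale ℓ' K')
  have hA : minScale ℓ K ≤ A := le_max_left _ _
  have hA' : minScale ℓ' K' ≤ A := le_max_right _ _
  set B : ℕ := transferBound L ℓ K ℓ' K' A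
  set B' : ℕ := transferBound L' ℓ' K' ℓ K A
  set D : ℕ := cutDepth ℓ K A
  set D' : ℕ := cutDepth ℓ' K' A
  refine ⟨B + B' + 1, 2 * D + D', |8 * A + 2 * (K * D)|, ?_, by positivity, abs_nonneg _, ?_⟩
  · linarith [Nat.cast_nonneg (α := ℝ) B, Nat.cast_nonneg (α := ℝ) B']
  intro V W p q hp hq
  obtain ⟨T, hT, hTH⟩ := hV L V p hp
  obtain ⟨T', hT', hTH'⟩ := hW L' W q hq
  refine ⟨T.transfer T' A, ⟨fun x y => ?_, fun x y => ?_, fun w => ?_⟩, fun x y s t hs ht => ?_⟩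
  · rw [← hT, ← hT']
    have h₁ : (T'.graph.dist (T.transfer T' A x) (T.transfer T' A y) : ℝ) ≤
        B * T.graph.dist x y := by exact_mod_cast dist_transfer_le hA hA' x y
    have h₂ : (0 : ℝ) ≤ (B' + 1) * T.graph.dist x y := by positivity
    have h₃ : (0 : ℝ) ≤ 2 * D + D' := by positivity
    linarith
  · rw [← hT, ← hT']
    have h₁ : (T.graph.dist x y : ℝ) ≤
        B' * T'.graph.dist (T.transfer T' A x) (T.transfer T' A y) + 2 * D := by
      exact_mod_cast dist_le_dist_transfer hA hA' x y
    have h₂ : (0 : ℝ) ≤ (B + 1) * T'.graph.dist (T.transfer T' A x) (T.transfer T' A y) := by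
      positivity
    have h₃ : (0 : ℝ) ≤ (B + B') * (2 * D + D') + D' := by positivity
    rw [sub_le_iff_le_add, inv_mul_le_iff₀ (by positivity)]
    linarith
  · refine ⟨T'.transfer T A w, ?_⟩
    rw [← hT']
    have h₁ : (T'.graph.dist (T.transfer T' A (T'.transfer T A w)) w : ℝ) ≤ D' := by
      exact_mod_cast dist_transfer_transfer_le (T := T') (T' := T) hA' hA w
    linarith [Nat.cast_nonneg (α := ℝ) D]
  · rw [hs.eq_sub hTH, ht.eq_sub hTH']
    exact (abs_height_transfer_sub_le hA hA' x y).trans (le_abs_self _)
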